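/- Let $\phi=\frac{1+\sqrt5}{2}$. Take a regular pentagon with side length $1$ and a horizontal bottom side, and label its sides: bottom $3$, lower left $1$, upper left $4$, lower right $5$, upper right $2$. The double pentagon is the translation surface obtained from this pentagon and its centrally symmetric copy by identifying each side with the parallel side of the other copy (which gets the same label) by a translation. Let $u$ and $v$ be the diagonals of the pentagon going from the right, respectively left, end of the bottom side to the top vertex; they bound sector $3$, the closed sector of directions consisting of all combinations $au+bv$ with $a,b\ge0$. A trajectory is a straight line on the surface that avoids the conical singularity. A periodic trajectory, followed over its least period, is called a periodic orbit; it unfolds to a vector in the plane, its displacement vector. Its symbolic orbit is the cyclic word of labels of the consecutively crossed sides. Let $(c,d,e,f)$ be the numbers of occurrences, per period, of the pairs of consecutive symbols $\mathrm{I}=43$, $\mathrm{II}=41$, $\mathrm{III}=25$, $\mathrm{IV}=23$. Consider a periodic direction in sector $3$, that is, a direction in this sector in which there is a periodic orbit. Among the periodic orbits in this direction there are ones of least length (short orbits) and ones of greatest length (long orbits), and every periodic orbit in this direction is short or long. Let $(c,d,e,f)$ be the vector of a short orbit and $(C,D,E,F)$ that of a long orbit. Then the displacement vectors of these two orbits are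 $$(c\phi+e)u+(f\phi+d)v\quad\text{and}\quad (C\phi+E)u+(F\phi+D)v.$$ The length of the short orbit equals $$m\,[(c+f)\phi+(d+e)],\qquad m=\frac{\phi^2\sin36^\circ}{\cos\alpha},$$ where $\alpha$ is the angle between the trajectory and the bisector of the vectors $u$ and $v$; the length of the long orbit is $\phi$ times the length of the short one. -/

import Mathlib

noncomputable section

namespace DoublePentagon

/-- Vertices of the regular pentagon with side length `1` centred at `0`, with a horizontal bottom
side; vertex `0` is the top vertex, the others follow counterclockwise (`k` matters mod `5`). -/
def vertex (k : ℕ) : ℂ :=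
  ((1 / (2 * Real.sin (Real.pi / 5)) : ℝ) : ℂ) *
    Complex.exp (((Real.pi / 2 + 2 * Real.pi * k / 5 : ℝ) : ℂ) * Complex.I)

/-- The (closed, filled) regular pentagon. -/
def pentagon : Set ℂ := convexHull ℝ (Set.range vertex)

/-- The labels `1, 2, 3, 4, 5` of the sides. -/
inductive Label : Type
  | one | two | three | four | five

/-- The number of the first endpoint of a side, in counterclockwise order: the bottom side is `3`,
the left sides are `1` (lower) and `4` (upper), the right sides are `5` (lower) and `2` (upper). -/
def Label.start : Label → ℕ
  | .four => 0
  | .one => 1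
  | .three => 2
  | .five => 3
  | .two => 4

/-- The side of the pentagon with a given label. -/
def side (i : Label) : Set ℂ := segment ℝ (vertex i.start) (vertex (i.start + 1))

/-- `true` stands for the pentagon, `false` for its centrally symmetric copy. -/
def sign : Bool → ℂ
  | true => 1
  | false => -1

/-- The two copies of the pentagon. -/
def copy (b : Bool) : Set ℂ := {z | sign b * z ∈ pentagon}

/-- The disjoint union of the two copies of the pentagon. -/
def Pieces : Type := {x : Bool × ℂ // x.2 ∈ copy x.1}

/-- Each side of the pentagon is identified with the parallel side of its centrally symmetric copy
by the translation that carries the one to the other (the first endpoint of the side goes to the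
opposite of the second one). -/
def Glue (x y : Pieces) : Prop :=
  ∃ i : Label, x.1.1 = true ∧ y.1.1 = false ∧ x.1.2 ∈ side i ∧
    y.1.2 = x.1.2 - (vertex i.start + vertex (i.start + 1))

/-- The double pentagon. -/
def Surface : Type := Quot Glue

/-- The point of the double pentagon given by a point of one of the two copies. -/
def point (b : Bool) (z : ℂ) (h : z ∈ copy b) : Surface := Quot.mk Glue ⟨(b, z), h⟩

/-- The conical singularity: the image of the vertices of both copies. -/
def singular : Set Surface :=
  {x | ∃ (b : Bool) (z : ℂ) (h : z ∈ copy b), x = point b z h ∧ ∃ k : ℕ, sign b * z = vertex k}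

/-- The side with a given label, on the double pentagon. -/
def sideOn (i : Label) : Set Surface :=
  {x | ∃ (z : ℂ) (h : z ∈ copy true), x = point true z h ∧ z ∈ side i}

/-- The straight line, run through with velocity `w`. -/
def line (w : ℂ) (t : ℝ) : ℂ := (t : ℂ) * w

/-- `γ` is a (nonsingular, bi-infinite) linear trajectory with velocity `w`: it avoids the
singularity and unfolds to the straight line `line w`. That is, immediately after each time, and
immediately before it, `γ` runs in one of the two pentagons and agrees there, up to a parallel
translation, with `line w`. -/
structure IsTrajectory (w : ℂ) (γ : ℝ → Surface) : Prop where
  nonsingular : ∀ t, γ t ∉ singular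
  forward : ∀ t, ∃ ε > 0, ∃ (b : Bool) (τ : ℂ), ∀ s ∈ Set.Ico t (t + ε),
    ∃ h : line w s - τ ∈ copy b, γ s = point b (line w s - τ) h
  backward : ∀ t, ∃ ε > 0, ∃ (b : Bool) (τ : ℂ), ∀ s ∈ Set.Ioc (t - ε) t,
    ∃ h : line w s - τ ∈ copy b, γ s = point b (line w s - τ) h

/-- A periodic trajectory with velocity `w`, together with its least period. -/
structure PeriodicOrbit (w : ℂ) where
  γ : ℝ → Surface
  trajectory : IsTrajectory w γ
  period : ℝ
  period_pos : 0 < period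
  periodic : Function.Periodic γ period
  period_le : ∀ p : ℝ, 0 < p → Function.Periodic γ p → period ≤ p

namespace PeriodicOrbit

variable {w : ℂ}

/-- The length of a periodic orbit: speed times period. -/
def length (O : PeriodicOrbit w) : ℝ := ‖w‖ * O.period

/-- The displacement vector: the vector to which one period of the orbit unfolds. -/
def displacement (O : PeriodicOrbit w) : ℂ := line w O.period - line w 0

/-- The orbit crosses side `i` at time `t`, and side `j` is the next side it crosses. -/
def Crosses (O : PeriodicOrbit w) (i j : Label) (t : ℝ) : Prop :=
  O.γ t ∈ sideOn i ∧ ∃ t' > t, O.γ t' ∈ sideOn j ∧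
    ∀ s ∈ Set.Ioo t t', ∀ k : Label, O.γ s ∉ sideOn k

/-- The number of times per period that `i` is followed by `j` in the symbolic orbit. -/
def count (O : PeriodicOrbit w) (i j : Label) : ℕ :=
  Set.ncard {t : ℝ | t ∈ Set.Ico 0 O.period ∧ O.Crosses i j t}

/-- The number of symbols `I = 43`. -/
def numI (O : PeriodicOrbit w) : ℕ := O.count .four .three

/-- The number of symbols `II = 41`. -/
def numII (O : PeriodicOrbit w) : ℕ := O.count .four .one

/-- The number of symbols `III = 25`. -/
def numIII (O : PeriodicOrbit w) : ℕ := O.count .two .five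

/-- The number of symbols `IV = 23`. -/
def numIV (O : PeriodicOrbit w) : ℕ := O.count .two .three

/-- A short periodic orbit: one of least length among the periodic orbits with its direction. -/
def IsShort (O : PeriodicOrbit w) : Prop := ∀ O' : PeriodicOrbit w, O.length ≤ O'.length

/-- A long periodic orbit: one of greatest length among the periodic orbits with its direction. -/
def IsLong (O : PeriodicOrbit w) : Prop := ∀ O' : PeriodicOrbit w, O'.length ≤ O.length

end PeriodicOrbit

/-- The diagonal from the right end of the bottom side to the top vertex. -/
def diagU : ℂ := vertex 0 - vertex 3

/-- The diagonal from the left end of the bottom side to the top vertex. -/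
def diagV : ℂ := vertex 0 - vertex 2

/-- The closed sector of directions bounded by the diagonals `diagU` and `diagV`. -/
def sector : Set ℂ := {w | ∃ a b : ℝ, 0 ≤ a ∧ 0 ≤ b ∧ w = (a : ℂ) * diagU + (b : ℂ) * diagV}

end DoublePentagon

end

/-! Write the direction as `a • u + b • v` with `a, b ≥ 0`. The upper sides 4 and 2 form a
transversal of the flow. A trajectory leaving it goes down through the copy, leaves that by side 3,
1 or 5, and climbs through the pentagon back to 4 or 2. So the first return is an exchange of four
intervals, indexed by the symbols I, II, III, IV (`Step`), and a passage with symbol `i` unfolds, up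
to the change of position on the transversal, to the fixed vector `i.vec`: `φu`, `v`, `u` or `φv`.
Over a period the changes of position cancel, and the displacement is the sum of these vectors. This
is the displacement formula.

The ratio `φ` comes from renormalization. First return of the exchange to a well-chosen subinterval
is an exchange of the same family with new parameters: a mirror image (`isInduced_swap`), a shear
when `bφ ≤ a` (`isInduced_shear`), and a map of the remaining range `b ≤ a ≤ bφ`
(`isInduced_middle`). Each replaces symbols by words, and on displacements acts by a linear map, so
it preserves the property that the primitive loops have exactly two displacements `D` and `φD`. For
`b > 0` the last two strictly shorten a primitive loop, so starting from any periodic direction the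
procedure reaches `b = 0`. There the exchange is the identity, with the two displacements `u` and
`φu` (`twoLoops_zero`). The induction is `twoLoops_of_isLoop`.

The passage between geometry and combinatorics rests on uniqueness of straight curves that avoid the
singularity (`IsPath.eq`), on the realization of every step by a piece of trajectory
(`Step.exists_isLeg`), and on the fact that the endpoints excluded from the exchanged intervals run
into vertices (`IsTrajectory.exists_step`). Hence periodic orbits correspond to primitive loops
(`exists_periodicOrbit`, `PeriodicOrbit.exists_isPrimitive`), and the symbol counts are the letter
counts (`PeriodicOrbit.count_eq`). The length formula follows because the bisector of `u` and `v` is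
vertical and `φ² sin 36°` is the height of the pentagon (`height_eq`, `cos_angle_bisector`). -/

namespace DoublePentagon

open scoped goldenRatio

/-! ### Partial maps with labels: loops, primitive loops and first-return induction -/

section LabelledRelation

variable {ι κ X Y : Type*}

/-- `Run R l x y`: the labelled relation `R` leads from `x` to `y` along the word `l`. -/
def Run (R : ι → X → X → Prop) : List ι → X → X → Prop
  | [], x, y => x = y
  | i :: l, x, y => ∃ z, R i x z ∧ Run R l z y

/-- Every point has at most one label and one successor. -/
def Deterministic (R : ι → X → X → Prop) : Prop :=
  ∀ ⦃i j x y z⦄, R i x y → R j x z → i = j ∧ y = z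

/-- A nonempty word leading from `x` back to `x`. -/
def IsLoop (R : ι → X → X → Prop) (l : List ι) (x : X) : Prop := l ≠ [] ∧ Run R l x x

/-- A shortest loop at `x`. -/
def IsPrimitive (R : ι → X → X → Prop) (l : List ι) (x : X) : Prop :=
  IsLoop R l x ∧ ∀ l', IsLoop R l' x → l.length ≤ l'.length

variable {R : ι → X → X → Prop}

@[simp] lemma run_nil {x y : X} : Run R [] x y ↔ x = y := Iff.rfl

lemma run_cons {i : ι} {l : List ι} {x y : X} :
    Run R (i :: l) x y ↔ ∃ z, R i x z ∧ Run R l z y := Iff.rfl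

lemma run_append {l m : List ι} {x y : X} :
    Run R (l ++ m) x y ↔ ∃ z, Run R l x z ∧ Run R m z y := by
  induction l generalizing x with
  | nil => simp
  | cons i l ih =>
    simp only [List.cons_append, run_cons, ih]
    constructor
    · rintro ⟨z, hz, t, h1, h2⟩; exact ⟨t, ⟨z, hz, h1⟩, h2⟩
    · rintro ⟨t, ⟨z, hz, h1⟩, h2⟩; exact ⟨z, hz, t, h1, h2⟩

lemma run_singleton {i : ι} {x y : X} : Run R [i] x y ↔ R i x y := by
  simp [run_cons]

lemma run_flip {l : List ι} {x y : X} :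
    Run (fun i a b => R i b a) l x y ↔ Run R l.reverse y x := by
  induction l generalizing x with
  | nil => simp [eq_comm]
  | cons i l ih =>
    simp only [run_cons, ih, List.reverse_cons, run_append]
    constructor
    · rintro ⟨z, h1, h2⟩; exact ⟨z, h2, run_singleton.2 h1⟩
    · rintro ⟨z, h1, h2⟩; exact ⟨z, run_singleton.1 h2, h1⟩

/-- By determinism, of two runs from the same point the shorter is an initial part of the longer. -/
lemma Deterministic.exists_append (hR : Deterministic R) {l m : List ι} {x y z : X}
    (hl : Run R l x y) (hm : Run R m x z) (h : l.length ≤ m.length) :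
    ∃ r, m = l ++ r ∧ Run R r y z := by
  induction l generalizing x m with
  | nil => cases hl; exact ⟨m, rfl, hm⟩
  | cons i l ih =>
    cases m with
    | nil => simp at h
    | cons j m =>
      obtain ⟨t, h1, h2⟩ := hl
      obtain ⟨t', h1', h2'⟩ := hm
      obtain ⟨rfl, rfl⟩ := hR h1 h1'
      obtain ⟨r, rfl, hr⟩ := ih h2 h2' (by simpa using h)
      exact ⟨r, rfl, hr⟩

lemma IsLoop.exists_primitive {l : List ι} {x : X} (h : IsLoop R l x) :
    ∃ p, IsPrimitive R p x := by
  classical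
  have hex : ∃ n, ∃ l, IsLoop R l x ∧ l.length = n := ⟨_, l, h, rfl⟩
  obtain ⟨p, hp, hn⟩ := Nat.find_spec hex
  exact ⟨p, hp, fun l' hl' => hn ▸ Nat.find_min' hex ⟨l', hl', rfl⟩⟩

lemma IsLoop.exists_step {l : List ι} {x : X} (h : IsLoop R l x) :
    ∃ i z l', R i x z ∧ IsLoop R l' z := by
  obtain ⟨hne, hrun⟩ := h
  cases l with
  | nil => exact absurd rfl hne
  | cons i l =>
    obtain ⟨z, h1, h2⟩ := hrun
    exact ⟨i, z, l ++ [i], h1, by simp, run_append.2 ⟨x, h2, run_singleton.2 h1⟩⟩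

lemma IsPrimitive.eq (hR : Deterministic R) {l m : List ι} {x : X}
    (hl : IsPrimitive R l x) (hm : IsPrimitive R m x) : l = m := by
  have h := le_antisymm (hl.2 m hm.1) (hm.2 l hl.1)
  obtain ⟨r, rfl, -⟩ := hR.exists_append hl.1.2 hm.1.2 h.le
  have : r.length = 0 := by simpa using h
  simp [List.length_eq_zero_iff.1 this]

lemma IsPrimitive.exists_append (hR : Deterministic R) {l m : List ι} {x : X}
    (hl : IsPrimitive R l x) (hm : IsLoop R m x) : ∃ r, m = l ++ r :=
  let ⟨r, h, _⟩ := hR.exists_append hl.1.2 hm.2 (hl.2 m hm)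
  ⟨r, h⟩

/-- A loop `m` at `y` makes `i :: (m ++ l)` a loop at `x`. Removing its initial part `i :: l` leaves
a loop at `x` as long as `m`, so primitivity at `x` bounds the length of `m`. -/
lemma IsPrimitive.rotate (hR : Deterministic R) {i : ι} {l : List ι} {x y : X}
    (h : IsPrimitive R (i :: l) x) (hi : R i x y) : IsPrimitive R (l ++ [i]) y := by
  have hly : Run R l y x := by
    obtain ⟨z, h1, h2⟩ := h.1.2
    obtain ⟨-, rfl⟩ := hR hi h1
    exact h2
  refine ⟨⟨by simp, run_append.2 ⟨x, hly, run_singleton.2 hi⟩⟩, fun m hm => ?_⟩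
  have hq : Run R (i :: (m ++ l)) x x := ⟨y, hi, run_append.2 ⟨y, hm.2, hly⟩⟩
  obtain ⟨r, hr, hrun⟩ := hR.exists_append h.1.2 hq (by simp)
  have hlen : r.length = m.length := by
    have := congrArg List.length hr
    simp at this
    omega
  have hne : r ≠ [] := by
    rintro rfl
    exact hm.1 (List.length_eq_zero_iff.1 hlen.symm)
  have := h.2 r ⟨hne, hrun⟩
  simp at this ⊢
  omega

/-- Moving the base point along the orbit rotates the word. Displacements depend only on the word up
to permutation, so the base point is irrelevant. -/
lemma IsPrimitive.exists_perm (hR : Deterministic R) {l m : List ι} {x y : X}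
    (h : IsPrimitive R l x) (hm : Run R m x y) : ∃ l', IsPrimitive R l' y ∧ l'.Perm l := by
  induction m generalizing x l with
  | nil => cases hm; exact ⟨l, h, List.Perm.refl _⟩
  | cons j m ih =>
    obtain ⟨z, hj, hm⟩ := hm
    cases l with
    | nil => exact absurd rfl h.1.1
    | cons i l =>
      obtain ⟨z', hi, -⟩ := h.1.2
      obtain ⟨rfl, rfl⟩ := hR hj hi
      obtain ⟨l', h1, h2⟩ := ih (h.rotate hR hj) hm
      exact ⟨l', h1, h2.trans (List.perm_append_comm (l₁ := l) (l₂ := [j]))⟩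

lemma isLoop_flip {l : List ι} {x : X} :
    IsLoop (fun i a b => R i b a) l x ↔ IsLoop R l.reverse x := by
  simp [IsLoop, run_flip]

lemma isPrimitive_flip {l : List ι} {x : X} :
    IsPrimitive (fun i a b => R i b a) l x ↔ IsPrimitive R l.reverse x := by
  simp only [IsPrimitive, isLoop_flip, List.length_reverse]
  refine and_congr_right fun _ => ⟨fun h m hm => ?_, fun h m hm => ?_⟩
  · simpa using h m.reverse (by simpa using hm)
  · simpa using h m.reverse hm

/-- `S` is, via `h`, the first return relation of `R` to the points `h x` with `x ∈ K`; a step of `S`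
with label `i` is a run of `R` along the word `σ i`. -/
structure IsInduced (R : ι → X → X → Prop) (S : κ → Y → Y → Prop) (h : Y → X)
    (σ : κ → List ι) (K : Set Y) : Prop where
  det : Deterministic R
  det_induced : Deterministic S
  injective : Function.Injective h
  ne_nil : ∀ i, σ i ≠ []
  mem : ∀ {i x y}, S i x y → x ∈ K
  run : ∀ {i x y}, S i x y → Run R (σ i) (h x) (h y)
  first_return : ∀ {l x y}, x ∈ K → y ∈ K → l ≠ [] → Run R l (h x) (h y) →
    ∃ i z, S i x z ∧ z ∈ K ∧ σ i <+: l
  reach : ∀ {l x}, IsLoop R l x → ∃ m, ∃ y ∈ K, Run R m x (h y)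

namespace IsInduced

variable {S : κ → Y → Y → Prop} {h : Y → X} {σ : κ → List ι} {K : Set Y}

lemma run_flatMap (H : IsInduced R S h σ K) {m : List κ} {x y : Y} (hm : Run S m x y) :
    Run R (m.flatMap σ) (h x) (h y) := by
  induction m generalizing x with
  | nil => cases hm; rfl
  | cons i m ih =>
    obtain ⟨z, h1, h2⟩ := hm
    exact run_append.2 ⟨_, H.run h1, ih h2⟩

/-- Peeling off first returns one at a time decodes a run of `R` between points of the section. -/
lemma exists_flatMap (H : IsInduced R S h σ K) {l : List ι} {x y : Y} (hx : x ∈ K) (hy : y ∈ K)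
    (hl : Run R l (h x) (h y)) : ∃ m, Run S m x y ∧ m.flatMap σ = l := by
  induction hn : l.length using Nat.strong_induction_on generalizing l x with
  | _ n ih =>
    by_cases hne : l = []
    · subst hne
      exact ⟨[], H.injective hl, rfl⟩
    · obtain ⟨i, z, hi, hz, r, rfl⟩ := H.first_return hx hy hne hl
      obtain ⟨r', hr, hrun⟩ := H.det.exists_append (H.run hi) hl (by simp)
      obtain rfl : r = r' := List.append_cancel_left hr
      have hpos := List.length_pos_of_ne_nil (H.ne_nil i)
      obtain ⟨m, hm, rfl⟩ := ih r.length (by simp at hn; omega) hz hrun rfl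
      exact ⟨i :: m, ⟨z, hi, hm⟩, rfl⟩

lemma flatMap_ne_nil (H : IsInduced R S h σ K) {m : List κ} (hm : m ≠ []) :
    m.flatMap σ ≠ [] := by
  cases m with
  | nil => exact absurd rfl hm
  | cons i m => simp [H.ne_nil i]

lemma mem_of_isLoop (H : IsInduced R S h σ K) {m : List κ} {x : Y} (hm : IsLoop S m x) : x ∈ K :=
  let ⟨_, _, _, h, _⟩ := hm.exists_step
  H.mem h

lemma isPrimitive_flatMap (H : IsInduced R S h σ K) {m : List κ} {x : Y}
    (hm : IsPrimitive S m x) : IsPrimitive R (m.flatMap σ) (h x) := by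
  refine ⟨⟨H.flatMap_ne_nil hm.1.1, H.run_flatMap hm.1.2⟩, fun l hl => ?_⟩
  have hx := H.mem_of_isLoop hm.1
  obtain ⟨m', hm', rfl⟩ := H.exists_flatMap hx hx hl.2
  have hne : m' ≠ [] := by rintro rfl; exact hl.1 rfl
  obtain ⟨r, rfl⟩ := hm.exists_append H.det_induced ⟨hne, hm'⟩
  simp

/-- Move the base point into the section and decode. A primitive loop of `S` at the decoded point
has a primitive image, which is the given loop by uniqueness of primitive loops. -/
lemma exists_isPrimitive (H : IsInduced R S h σ K) {l : List ι} {x : X}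
    (hl : IsPrimitive R l x) : ∃ m y, IsPrimitive S m y ∧ (m.flatMap σ).Perm l := by
  obtain ⟨p, y, hy, hp⟩ := H.reach hl.1
  obtain ⟨l', hl', hperm⟩ := hl.exists_perm H.det hp
  obtain ⟨m, hm, rfl⟩ := H.exists_flatMap hy hy hl'.1.2
  have hne : m ≠ [] := by rintro rfl; exact hl'.1.1 rfl
  obtain ⟨m₀, hm₀⟩ := IsLoop.exists_primitive (R := S) ⟨hne, hm⟩
  exact ⟨m₀, y, hm₀, (H.isPrimitive_flatMap hm₀).eq H.det hl' ▸ hperm⟩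

end IsInduced

end LabelledRelation

/-! ### The interval exchange and the displacement of words -/

/-- The four pairs of consecutive labels that begin with `4` or `2`: `I = 43`, `II = 41`, `III = 25`,
`IV = 23`. -/
inductive Symbol : Type
  | I | II | III | IV
  deriving DecidableEq

namespace Symbol

/-- The coordinates with respect to `diagU` and `diagV` of the displacement that belongs to a
symbol. -/
noncomputable def vec : Symbol → ℝ × ℝ
  | I => (φ, 0)
  | II => (0, 1)
  | III => (1, 0)
  | IV => (0, φ)

/-- The effect on symbols of exchanging `diagU` and `diagV`. -/
def swap : Symbol → Symbol
  | I => IV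
  | II => III
  | III => II
  | IV => I

end Symbol

open DoublePentagon.Symbol

/-- The displacement of a word. -/
noncomputable def disp (l : List Symbol) : ℝ × ℝ := (l.map vec).sum

@[simp] lemma disp_nil : disp [] = 0 := rfl

@[simp] lemma disp_cons (i : Symbol) (l : List Symbol) : disp (i :: l) = i.vec + disp l := by
  simp [disp]

@[simp] lemma disp_append (l m : List Symbol) : disp (l ++ m) = disp l + disp m := by
  simp [disp]

lemma disp_perm {l m : List Symbol} (h : l.Perm m) : disp l = disp m := (h.map vec).sum_eq

lemma one_le_vec (i : Symbol) : 1 ≤ i.vec.1 + i.vec.2 := by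
  cases i <;> simp [vec, Real.one_lt_goldenRatio.le]

/-- Every symbol adds at least 1 to the sum of the coordinates. This makes displacements of loops
positive and long runs last long. -/
lemma length_le_disp (l : List Symbol) : (l.length : ℝ) ≤ (disp l).1 + (disp l).2 := by
  induction l with
  | nil => simp
  | cons i l ih =>
    have := one_le_vec i
    simp only [disp_cons, Prod.fst_add, Prod.snd_add, List.length_cons, Nat.cast_add, Nat.cast_one]
    linarith

lemma disp_eq (l : List Symbol) :
    disp l = (l.count I * φ + l.count III, l.count IV * φ + l.count II) := by
  induction l with
  | nil => simp [← Prod.zero_eq_mk]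
  | cons i l ih =>
    rw [disp_cons, ih]
    cases i <;> simp [vec] <;> ring

/-- The interval exchange induced by the flow in direction `a • diagU + b • diagV` on the sides `4`
and `2`, as a relation on the interiors of the exchanged intervals. -/
def Step (a b : ℝ) : Symbol → ℝ → ℝ → Prop
  | IV, s, t => -(a * φ) < s ∧ s < b - a * φ ∧ t = s + a * φ
  | III, s, t => b - a * φ < s ∧ s < b - a ∧ t = s - b
  | II, s, t => b - a < s ∧ s < b * φ - a ∧ t = s + a
  | I, s, t => b * φ - a < s ∧ s < b * φ ∧ t = s - b * φ

lemma mul_golden_sq (x : ℝ) : x * φ ^ 2 = x * φ + x := by rw [Real.goldenRatio_sq]; ring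

lemma mul_golden_mono {x y : ℝ} (h : x ≤ y) : x * φ ≤ y * φ :=
  mul_le_mul_of_nonneg_right h Real.goldenRatio_pos.le

lemma le_mul_golden {x : ℝ} (h : 0 ≤ x) : x ≤ x * φ :=
  le_mul_of_one_le_right h Real.one_lt_goldenRatio.le

lemma step_deterministic {a b : ℝ} (ha : 0 ≤ a) (hb : 0 ≤ b) : Deterministic (Step a b) := by
  have := le_mul_golden ha
  have := le_mul_golden hb
  intro i j x y z hi hj
  cases i <;> cases j <;> simp only [Step] at hi hj <;> obtain ⟨h1, h2, rfl⟩ := hi <;>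
    obtain ⟨h3, h4, rfl⟩ := hj <;> first | exact ⟨rfl, rfl⟩ | (exfalso; linarith)

/-- The images of the four intervals, in the order III, I, IV, II, are again disjoint. -/
lemma step_flip_deterministic {a b : ℝ} (ha : 0 ≤ a) (hb : 0 ≤ b) :
    Deterministic (fun i x y => Step a b i y x) := by
  have := le_mul_golden ha
  have := le_mul_golden hb
  intro i j x y z hi hj
  cases i <;> cases j <;> simp only [Step] at hi hj <;> obtain ⟨h1, h2, h5⟩ := hi <;>
    obtain ⟨h3, h4, h6⟩ := hj <;>
    first | (exact ⟨rfl, by linarith⟩) | (exfalso; linarith)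

lemma Step.mem {a b : ℝ} (ha : 0 ≤ a) (hb : 0 ≤ b) {i : Symbol} {x y : ℝ} (h : Step a b i x y) :
    x ∈ Set.Ioo (-(a * φ)) (b * φ) ∧ y ∈ Set.Ioo (-(a * φ)) (b * φ) := by
  have := le_mul_golden ha
  have := le_mul_golden hb
  simp only [Set.mem_Ioo]
  cases i <;> simp only [Step] at h <;> obtain ⟨h1, h2, rfl⟩ := h <;>
    refine ⟨⟨?_, ?_⟩, ?_, ?_⟩ <;> linarith

/-- Each step is a translation by `-b * i.vec.1 + a * i.vec.2`, so a closed run must have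
displacement parallel to `(a, b)`. -/
lemma Run.position_eq {a b : ℝ} {l : List Symbol} {s t : ℝ} (h : Run (Step a b) l s t) :
    t = s - b * (disp l).1 + a * (disp l).2 := by
  induction l generalizing s with
  | nil => cases h; simp
  | cons i l ih =>
    obtain ⟨z, hz, hl⟩ := h
    rw [ih hl, disp_cons]
    cases i <;> simp only [Step] at hz <;> obtain ⟨-, -, rfl⟩ := hz <;> simp [vec] <;> ring

/-- The primitive loops have two displacements, one of which is `φ` times the other. -/
def TwoLoops (R : Symbol → ℝ → ℝ → Prop) : Prop :=
  ∃ D : ℝ × ℝ, (∃ l s, IsPrimitive R l s ∧ disp l = D) ∧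
    (∃ l s, IsPrimitive R l s ∧ disp l = φ • D) ∧
    ∀ l s, IsPrimitive R l s → disp l = D ∨ disp l = φ • D

lemma disp_flatMap {σ : Symbol → List Symbol} {M : ℝ × ℝ →ₗ[ℝ] ℝ × ℝ}
    (hM : ∀ i, disp (σ i) = M i.vec) (l : List Symbol) : disp (l.flatMap σ) = M (disp l) := by
  induction l with
  | nil => simp
  | cons i l ih => simp [ih, hM]

/-- Primitive loops correspond in both directions under induction, and the linear map `M` respects
the factor `φ`. -/
lemma TwoLoops.of_isInduced {R S : Symbol → ℝ → ℝ → Prop} {h : ℝ → ℝ}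
    {σ : Symbol → List Symbol} {K : Set ℝ} (H : IsInduced R S h σ K) {M : ℝ × ℝ →ₗ[ℝ] ℝ × ℝ}
    (hM : ∀ i, disp (σ i) = M i.vec) (hS : TwoLoops S) : TwoLoops R := by
  obtain ⟨D, ⟨l, s, hl, hD⟩, ⟨l', s', hl', hD'⟩, hall⟩ := hS
  refine ⟨M D, ⟨_, _, H.isPrimitive_flatMap hl, ?_⟩, ⟨_, _, H.isPrimitive_flatMap hl', ?_⟩, ?_⟩
  · rw [disp_flatMap hM, hD]
  · rw [disp_flatMap hM, hD', map_smul]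
  · intro m t hm
    obtain ⟨k, y, hk, hperm⟩ := H.exists_isPrimitive hm
    rw [← disp_perm hperm, disp_flatMap hM, ← map_smul]
    exact (hall k y hk).imp (congrArg M) (congrArg M)

lemma TwoLoops.of_flip {R : Symbol → ℝ → ℝ → Prop}
    (h : TwoLoops R) : TwoLoops (fun i x y => R i y x) := by
  obtain ⟨D, ⟨l, s, hl, hD⟩, ⟨l', s', hl', hD'⟩, hall⟩ := h
  refine ⟨D, ⟨l.reverse, s, isPrimitive_flip.2 (by simpa using hl), ?_⟩,
    ⟨l'.reverse, s', isPrimitive_flip.2 (by simpa using hl'), ?_⟩, fun m t hm => ?_⟩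
  · rw [disp_perm (List.reverse_perm l), hD]
  · rw [disp_perm (List.reverse_perm l'), hD']
  · rw [← disp_perm (List.reverse_perm m)]
    exact hall _ _ (isPrimitive_flip.1 hm)

/-! ### Renormalization: the reflection exchanging the diagonals -/

section Swap

lemma step_swap {a b : ℝ} {i : Symbol} {x y : ℝ} (h : Step b a i x y) :
    Step a b i.swap (-x) (-y) := by
  cases i <;> simp only [Step, swap] at h ⊢ <;> obtain ⟨h1, h2, rfl⟩ := h <;>
    refine ⟨?_, ?_, ?_⟩ <;> linarith

lemma swap_swap (i : Symbol) : i.swap.swap = i := by cases i <;> rfl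

lemma isInduced_swap {a b : ℝ} (ha : 0 ≤ a) (hb : 0 ≤ b) :
    IsInduced (Step a b) (Step b a) (fun x => -x) (fun i => [i.swap])
      (Set.Ioo (-(b * φ)) (a * φ)) where
  det := step_deterministic ha hb
  det_induced := step_deterministic hb ha
  injective := neg_injective
  ne_nil _ := by simp
  mem h := (h.mem hb ha).1
  run h := run_singleton.2 (step_swap h)
  first_return {l x y} _ _ hl hrun := by
    obtain _ | ⟨i, l⟩ := l
    · exact absurd rfl hl
    · obtain ⟨z, hz, -⟩ := hrun
      have := step_swap hz
      rw [neg_neg] at this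
      exact ⟨i.swap, -z, this, (this.mem hb ha).2, by simp [swap_swap]⟩
  reach {l x} h := by
    obtain ⟨i, z, -, hz, -⟩ := h.exists_step
    have := (hz.mem ha hb).1
    exact ⟨[], -x, ⟨by linarith [this.2], by linarith [this.1]⟩, by simp⟩

end Swap

/-! ### Renormalization: directions close to the diagonal `u` -/

section Shear

/-- The words of the first return to a smaller interval for directions close to `diagU`. -/
def shearWord : Symbol → List Symbol
  | I => [I]
  | II => [II, I]
  | III => [III]
  | IV => [III, IV, I]

/-- Since `φ² = φ + 1`, the shift carries the new interval onto `(b - a * φ, 0)`, which omits the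
domain of IV and the nonnegative points. As `b * φ ≤ a`, every exchanged nonnegative point lies in
the domain of I and returns at once; a point below `b - a * φ` returns through IV and then I. -/
lemma isInduced_shear {a b : ℝ} (hb : 0 ≤ b) (hab : b * φ ≤ a) :
    IsInduced (Step a b) (Step (a - b * φ) b) (fun x => x - b * φ) shearWord
      (Set.Ioo (-((a - b * φ) * φ)) (b * φ)) := by
  have hb2 := mul_golden_sq b
  have hb1 := le_mul_golden hb
  have ha : 0 ≤ a := by linarith
  have hab' := mul_golden_mono hab
  have hab'' := le_mul_golden (sub_nonneg.2 hab)
  have ha1 := le_mul_golden ha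
  refine ⟨step_deterministic ha hb, step_deterministic (by linarith) hb, sub_left_injective,
    ?_, fun h => (h.mem (by linarith) hb).1, ?_, ?_, ?_⟩
  · intro i; cases i <;> simp [shearWord]
  · intro i x y h
    cases i <;> simp only [Step] at h <;> obtain ⟨h1, h2, rfl⟩ := h <;>
      simp only [shearWord, run_cons, run_nil, Step]
    · exact ⟨_, ⟨by linarith, by linarith, rfl⟩, by ring⟩
    · exact ⟨_, ⟨by linarith, by linarith, rfl⟩, _, ⟨by linarith, by linarith, rfl⟩, by ring⟩
    · exact ⟨_, ⟨by linarith, by linarith, rfl⟩, by ring⟩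
    · exact ⟨_, ⟨by linarith, by linarith, rfl⟩, _, ⟨by linarith, by linarith, rfl⟩, _,
        ⟨by linarith, by linarith, rfl⟩, by linarith⟩
  · rintro l x y ⟨hx1, hx2⟩ ⟨hy1, hy2⟩ hl hrun
    obtain _ | ⟨i, l⟩ := l
    · exact absurd rfl hl
    obtain ⟨z, hz, hrun⟩ := hrun
    cases i <;> simp only [Step] at hz <;> obtain ⟨h1, h2, rfl⟩ := hz
    · refine ⟨I, x - b * φ, ⟨?_, ?_, rfl⟩, ⟨?_, ?_⟩, ⟨l, rfl⟩⟩ <;> linarith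
    · obtain _ | ⟨j, l⟩ := l
      · simp only [run_nil] at hrun; linarith
      obtain ⟨z, hz, hrun⟩ := hrun
      cases j <;> simp only [Step] at hz <;> obtain ⟨h3, h4, rfl⟩ := hz <;>
        [skip; (exfalso; linarith); (exfalso; linarith); (exfalso; linarith)]
      refine ⟨II, x + (a - b * φ), ⟨?_, ?_, rfl⟩, ⟨?_, ?_⟩, ⟨l, rfl⟩⟩ <;> linarith
    · obtain _ | ⟨j, l⟩ := l
      · simp only [run_nil] at hrun
        refine ⟨III, x - b, ⟨?_, ?_, rfl⟩, ⟨?_, ?_⟩, ⟨[], rfl⟩⟩ <;> linarith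
      obtain ⟨z, hz, hrun⟩ := hrun
      cases j <;> simp only [Step] at hz <;> obtain ⟨h3, h4, rfl⟩ := hz
      iterate 3
        refine ⟨III, x - b, ⟨?_, ?_, rfl⟩, ⟨?_, ?_⟩, ⟨_, rfl⟩⟩ <;> linarith
      obtain _ | ⟨k, l⟩ := l
      · simp only [run_nil] at hrun; linarith
      obtain ⟨z, hz, hrun⟩ := hrun
      cases k <;> simp only [Step] at hz <;> obtain ⟨h5, h6, rfl⟩ := hz <;>
        [skip; (exfalso; linarith); (exfalso; linarith); (exfalso; linarith)]
      refine ⟨IV, x + (a - b * φ) * φ, ⟨?_, ?_, rfl⟩, ⟨?_, ?_⟩, ⟨l, rfl⟩⟩ <;> linarith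
    · exfalso; linarith
  · intro l x hl
    -- Outside the section a point with a loop is either nonnegative, and I brings it back, or in
    -- the domain of IV, which makes it nonnegative.
    have nonneg_case : ∀ {l x}, IsLoop (Step a b) l x → 0 ≤ x → ∃ m, ∃ y ∈
        Set.Ioo (-((a - b * φ) * φ)) (b * φ), Run (Step a b) m x (y - b * φ) := by
      intro l x hl hx
      obtain ⟨i, z, l, hz, hl⟩ := hl.exists_step
      have hz' := hz
      cases i <;> simp only [Step] at hz <;> obtain ⟨h1, h2, rfl⟩ := hz <;>
        [skip; (exfalso; linarith); (exfalso; linarith); (exfalso; linarith)]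
      refine ⟨[I], x, ⟨?_, by linarith⟩, run_singleton.2 hz'⟩
      obtain ⟨j, z, -, hj, -⟩ := hl.exists_step
      by_contra hlt
      have hx0 : x = 0 := by linarith
      subst hx0
      cases j <;> simp only [Step] at hj <;> obtain ⟨h3, h4, rfl⟩ := hj <;> linarith
    by_cases hx : 0 ≤ x
    · exact nonneg_case hl hx
    · obtain ⟨i, z, l', hz, hl'⟩ := hl.exists_step
      have hz' := hz
      by_cases hx' : b - a * φ < x
      · exact ⟨[], x + b * φ, ⟨by linarith, by linarith⟩, by simp⟩
      cases i <;> simp only [Step] at hz <;> obtain ⟨h1, h2, rfl⟩ := hz <;>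
        [(exfalso; linarith); (exfalso; linarith); (exfalso; linarith); skip]
      obtain ⟨m, y, hy, hm⟩ := nonneg_case hl' (by linarith)
      exact ⟨IV :: m, y, hy, _, hz', hm⟩

end Shear

/-! ### Renormalization: directions with `b ≤ a ≤ b * φ` -/

section Middle

/-- The words of the first return to the interval of `I` for directions in the middle. -/
def middleWord : Symbol → List Symbol
  | I => [I, III, IV]
  | II => [I, IV]
  | III => [I, II]
  | IV => [I, III, IV, II]

/-- The section is the domain `(b * φ - a, b * φ)` of I, onto which the reflection carries the new
interval; its constant is the sum of corresponding endpoints. Hence every word begins with I. The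
return map reflects to the inverse of an exchange of the family, which is why the arguments of
`Step` are interchanged. -/
lemma isInduced_middle {a b : ℝ} (ha : 0 < a) (hba : b ≤ a) (hab : a ≤ b * φ) :
    IsInduced (Step a b) (fun i x y => Step ((a - b) * φ) (b * φ - a) i y x)
      (fun x => 2 * (b * φ) + b - a * φ - a - x) middleWord
      (Set.Ioo (-((a - b) * φ * φ)) ((b * φ - a) * φ)) := by
  have hb : 0 < b := by
    by_contra h
    nlinarith [Real.goldenRatio_pos]
  have hb2 := mul_golden_sq b
  have ha2 := mul_golden_sq a
  have hb1 : b < b * φ := lt_mul_of_one_lt_right hb Real.one_lt_goldenRatio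
  have hba' := mul_golden_mono hba
  have hab' := mul_golden_mono hab
  have hab'' := le_mul_golden (sub_nonneg.2 hab)
  have ha1 : a < a * φ := lt_mul_of_one_lt_right ha Real.one_lt_goldenRatio
  have ha' : 0 ≤ (a - b) * φ := mul_nonneg (by linarith) Real.goldenRatio_pos.le
  have hb' : 0 ≤ b * φ - a := by linarith
  refine ⟨step_deterministic ha.le hb.le, step_flip_deterministic ha' hb',
    sub_right_injective, ?_, fun h => (h.mem ha' hb').2, ?_, ?_, ?_⟩
  · intro i; cases i <;> simp [middleWord]
  · intro i y x h
    cases i <;> simp only [Step] at h <;> obtain ⟨h1, h2, rfl⟩ := h <;>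
      simp only [middleWord, run_cons, run_nil, Step]
    · exact ⟨_, ⟨by linarith, by linarith, rfl⟩, _, ⟨by linarith, by linarith, rfl⟩, _,
        ⟨by linarith, by linarith, rfl⟩, by linarith⟩
    · exact ⟨_, ⟨by linarith, by linarith, rfl⟩, _, ⟨by linarith, by linarith, rfl⟩, by linarith⟩
    · exact ⟨_, ⟨by linarith, by linarith, rfl⟩, _, ⟨by linarith, by linarith, rfl⟩, by linarith⟩
    · exact ⟨_, ⟨by linarith, by linarith, rfl⟩, _, ⟨by linarith, by linarith, rfl⟩, _,
        ⟨by linarith, by linarith, rfl⟩, _, ⟨by linarith, by linarith, rfl⟩, by linarith⟩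
  · rintro l x y ⟨hx1, hx2⟩ ⟨hy1, hy2⟩ hl hrun
    obtain _ | ⟨i, l⟩ := l
    · exact absurd rfl hl
    obtain ⟨z, hz, hrun⟩ := hrun
    cases i <;> simp only [Step] at hz <;> obtain ⟨h1, h2, rfl⟩ := hz <;>
      [skip; (exfalso; linarith); (exfalso; linarith); (exfalso; linarith)]
    obtain _ | ⟨i, l⟩ := l
    · simp only [run_nil] at hrun; linarith
    obtain ⟨z, hz, hrun⟩ := hrun
    cases i <;> simp only [Step] at hz <;> obtain ⟨h3, h4, rfl⟩ := hz
    · exfalso; linarith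
    · refine ⟨III, x + (b * φ - a), ⟨?_, ?_, ?_⟩, ⟨?_, ?_⟩, ⟨l, rfl⟩⟩ <;> linarith
    · obtain _ | ⟨i, l⟩ := l
      · simp only [run_nil] at hrun; linarith
      obtain ⟨z, hz, hrun⟩ := hrun
      cases i <;> simp only [Step] at hz <;> obtain ⟨h5, h6, rfl⟩ := hz <;>
        [(exfalso; linarith); (exfalso; linarith); (exfalso; linarith); skip]
      obtain _ | ⟨i, l⟩ := l
      · simp only [run_nil] at hrun
        refine ⟨I, x + (b * φ - a) * φ, ⟨?_, ?_, ?_⟩, ⟨?_, ?_⟩, ⟨[], rfl⟩⟩ <;> linarith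
      obtain ⟨z, hz, hrun⟩ := hrun
      cases i <;> simp only [Step] at hz <;> obtain ⟨h7, h8, rfl⟩ := hz
      · refine ⟨I, x + (b * φ - a) * φ, ⟨?_, ?_, ?_⟩, ⟨?_, ?_⟩, ⟨_, rfl⟩⟩ <;> linarith
      · refine ⟨IV, x - (a - b) * φ * φ, ⟨?_, ?_, ?_⟩, ⟨?_, ?_⟩, ⟨_, rfl⟩⟩ <;> linarith
      · exfalso; linarith
      · exfalso; linarith
    · refine ⟨II, x - (a - b) * φ, ⟨?_, ?_, ?_⟩, ⟨?_, ?_⟩, ⟨l, rfl⟩⟩ <;> linarith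
  -- Where points outside the section go: III leads into the domain of IV, IV to nonnegative points,
  -- and there II leads into the domain of I.
  · have case_I : ∀ {l x}, IsLoop (Step a b) l x → b * φ - a < x → ∃ m, ∃ y ∈
        Set.Ioo (-((a - b) * φ * φ)) ((b * φ - a) * φ),
        Run (Step a b) m x (2 * (b * φ) + b - a * φ - a - y) := by
      intro l x hl hx
      obtain ⟨i, z, -, hz, -⟩ := hl.exists_step
      have hx2 := (hz.mem ha.le hb.le).1.2
      exact ⟨[], 2 * (b * φ) + b - a * φ - a - x, ⟨by linarith, by linarith⟩, by simp⟩
    have case_nonneg : ∀ {l x}, IsLoop (Step a b) l x → 0 ≤ x → ∃ m, ∃ y ∈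
        Set.Ioo (-((a - b) * φ * φ)) ((b * φ - a) * φ),
        Run (Step a b) m x (2 * (b * φ) + b - a * φ - a - y) := by
      intro l x hl hx
      by_cases hx' : b * φ - a < x
      · exact case_I hl hx'
      obtain ⟨i, z, l', hz, hl'⟩ := hl.exists_step
      have hz' := hz
      cases i <;> simp only [Step] at hz <;> obtain ⟨h1, h2, rfl⟩ := hz <;>
        [(exfalso; linarith); skip; (exfalso; linarith); (exfalso; linarith)]
      obtain ⟨m, y, hy, hm⟩ := case_I hl' (by linarith)
      exact ⟨II :: m, y, hy, _, hz', hm⟩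
    have case_IV : ∀ {l x}, IsLoop (Step a b) l x → x < b - a * φ → ∃ m, ∃ y ∈
        Set.Ioo (-((a - b) * φ * φ)) ((b * φ - a) * φ),
        Run (Step a b) m x (2 * (b * φ) + b - a * φ - a - y) := by
      intro l x hl hx
      obtain ⟨i, z, l', hz, hl'⟩ := hl.exists_step
      have hz' := hz
      cases i <;> simp only [Step] at hz <;> obtain ⟨h1, h2, rfl⟩ := hz <;>
        [(exfalso; linarith); (exfalso; linarith); (exfalso; linarith); skip]
      obtain ⟨m, y, hy, hm⟩ := case_nonneg hl' (by linarith)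
      exact ⟨IV :: m, y, hy, _, hz', hm⟩
    intro l x hl
    obtain ⟨i, z, l', hz, hl'⟩ := hl.exists_step
    have hz' := hz
    cases i <;> simp only [Step] at hz <;> obtain ⟨h1, h2, rfl⟩ := hz
    · exact case_I hl h1
    · obtain ⟨m, y, hy, hm⟩ := case_nonneg hl' (by linarith)
      exact ⟨II :: m, y, hy, _, hz', hm⟩
    · obtain ⟨m, y, hy, hm⟩ := case_IV hl' (by linarith)
      exact ⟨III :: m, y, hy, _, hz', hm⟩
    · exact case_IV hl h2

end Middle

/-! ### The ratio `φ`, by descent on the length of a loop -/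

lemma isPrimitive_singleton {ι X : Type*} {R : ι → X → X → Prop} {i : ι} {x : X} (h : R i x x) :
    IsPrimitive R [i] x :=
  ⟨⟨by simp, run_singleton.2 h⟩, fun l hl => by
    simpa [Nat.one_le_iff_ne_zero] using hl.1⟩

/-- The flow is along `u`: the domains of II and IV are empty, and I and III fix every point of
theirs. -/
lemma twoLoops_zero {a : ℝ} (ha : 0 < a) : TwoLoops (Step a 0) := by
  have ha1 : a < a * φ := lt_mul_of_one_lt_right ha Real.one_lt_goldenRatio
  have hI : ∀ s, -a < s → s < 0 → Step a 0 I s s := fun s h1 h2 => by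
    simp only [Step]; exact ⟨by linarith, by linarith, by ring⟩
  have hIII : ∀ s, -(a * φ) < s → s < -a → Step a 0 III s s := fun s h1 h2 => by
    simp only [Step]; exact ⟨by linarith, by linarith, by ring⟩
  refine ⟨(1, 0), ⟨[III], -(a * φ + a) / 2, isPrimitive_singleton
    (hIII _ (by linarith) (by linarith)), by simp [vec]⟩, ⟨[I], -a / 2, isPrimitive_singleton
    (hI _ (by linarith) (by linarith)), by simp [vec]⟩, fun l s hl => ?_⟩
  have hdet := step_deterministic ha.le le_rfl
  obtain ⟨i, z, -, hz, -⟩ := hl.1.exists_step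
  cases i <;> simp only [Step] at hz <;> obtain ⟨h1, h2, rfl⟩ := hz
  · right
    rw [hl.eq hdet (isPrimitive_singleton (hI s (by linarith) (by linarith)))]
    simp [vec]
  · exfalso; linarith
  · left
    rw [hl.eq hdet (isPrimitive_singleton (hIII s (by linarith) (by linarith)))]
    simp [vec]
  · exfalso; linarith

lemma length_flatMap_ge {σ : Symbol → List Symbol} (hσ : ∀ i, σ i ≠ []) (l : List Symbol) :
    l.length ≤ (l.flatMap σ).length := by
  induction l with
  | nil => simp
  | cons i l ih =>
    have := List.length_pos_of_ne_nil (hσ i)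
    simp only [List.length_cons, List.flatMap_cons, List.length_append]
    omega

lemma length_flatMap_gt {σ : Symbol → List Symbol} (hσ : ∀ i, σ i ≠ []) {l : List Symbol}
    {i : Symbol} (hi : i ∈ l) (h2 : 2 ≤ (σ i).length) : l.length < (l.flatMap σ).length := by
  obtain ⟨p, q, rfl⟩ := List.append_of_mem hi
  have h1 := length_flatMap_ge hσ p
  have h3 := length_flatMap_ge hσ q
  simp only [List.length_append, List.length_cons, List.flatMap_append, List.flatMap_cons]
  omega

lemma disp_snd_eq_zero {l : List Symbol} (h : ∀ i ∈ l, i = I ∨ i = III) : (disp l).2 = 0 := by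
  induction l with
  | nil => rfl
  | cons i l ih =>
    have := ih fun j hj => h j (by simp [hj])
    rcases h i (by simp) with rfl | rfl <;> simp [vec, this]

lemma IsLoop.balance {a b : ℝ} {l : List Symbol} {s : ℝ} (h : IsLoop (Step a b) l s) :
    b * (disp l).1 = a * (disp l).2 := by
  linarith [h.2.position_eq]

lemma IsLoop.disp_pos {R : Symbol → ℝ → ℝ → Prop} {l : List Symbol} {s : ℝ} (h : IsLoop R l s) :
    0 < (disp l).1 + (disp l).2 := by
  have := length_le_disp l
  have : (0 : ℝ) < l.length := by exact_mod_cast List.length_pos_of_ne_nil h.1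
  linarith

/-- The linear map with the given columns. -/
noncomputable def ofColumns (p q : ℝ × ℝ) : ℝ × ℝ →ₗ[ℝ] ℝ × ℝ :=
  (LinearMap.fst ℝ ℝ ℝ).smulRight p + (LinearMap.snd ℝ ℝ ℝ).smulRight q

@[simp] lemma ofColumns_apply (p q x : ℝ × ℝ) : ofColumns p q x = x.1 • p + x.2 • q := rfl

/-- Whenever there is a loop in a direction, the primitive loops have two displacements. -/
theorem twoLoops_of_isLoop {a b : ℝ} (ha : 0 ≤ a) (hb : 0 ≤ b) (hab : 0 < a + b)
    {l : List Symbol} {s : ℝ} (hl : IsLoop (Step a b) l s) : TwoLoops (Step a b) := by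
  induction hn : l.length using Nat.strong_induction_on generalizing a b l s with
  | _ n ih =>
  -- The case `b ≤ a` is isolated because the reflection does not shorten loops: the other case must
  -- be reduced to it at the same length, without the induction hypothesis.
  have key : ∀ {a b : ℝ}, 0 ≤ b → b ≤ a → 0 < a → ∀ {l s}, IsLoop (Step a b) l s → l.length = n →
      TwoLoops (Step a b) := by
    intro a b hb hba ha l s hl hn
    rcases hb.eq_or_lt with rfl | hb0
    · exact twoLoops_zero ha
    obtain ⟨p, hp⟩ := hl.exists_primitive
    have hφ := Real.goldenRatio_pos
    rcases le_or_gt (b * φ) a with hab | hab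
    · have H := isInduced_shear hb hab
      -- The matrix expresses the displacements of the return words in those of the letters; it also
      -- sends `(a - b * φ, b)` to `(a, b)`.
      refine TwoLoops.of_isInduced H (M := ofColumns (1, 0) (φ, 1)) (fun i => ?_) ?_
      · cases i <;> simp [shearWord, vec, ← sq]
        ring
      obtain ⟨m, y, hm, hperm⟩ := H.exists_isPrimitive hp
      refine ih m.length ?_ (by linarith) hb (by linarith) hm.1 rfl
      -- Only II and IV have return words of length at least 2. A loop in I and III alone would have
      -- second displacement 0, hence by balance (`b > 0`) first displacement 0 too, against
      -- positivity.
      have h1 : ∃ i ∈ m, ¬(i = I ∨ i = III) := by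
        by_contra! hcon
        have h1 := disp_snd_eq_zero hcon
        have h2 := hm.1.balance
        have h3 := hm.1.disp_pos
        rw [h1] at h2 h3
        nlinarith
      obtain ⟨i, hi, hne⟩ := h1
      have hlt := length_flatMap_gt H.ne_nil hi (by cases i <;> simp [shearWord] at hne ⊢)
      have := hp.2 l hl
      have := hperm.length_eq
      omega
    · have H := isInduced_middle ha hba hab.le
      refine TwoLoops.of_isInduced H (M := ofColumns (φ, 1) (φ, φ)) (fun i => ?_)
        (TwoLoops.of_flip (R := Step ((a - b) * φ) (b * φ - a)) ?_)
      · cases i <;> simp [middleWord, vec, ← sq]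
      obtain ⟨m, y, hm, hperm⟩ := H.exists_isPrimitive hp
      -- The loop `m` runs along the inverse exchange, so its reversal is a loop of the exchange
      -- itself.
      refine ih m.reverse.length ?_ (mul_nonneg (by linarith) hφ.le) (by linarith) ?_
        (isLoop_flip.1 hm.1) rfl
      · obtain ⟨i, hi⟩ := List.exists_mem_of_ne_nil m hm.1.1
        have hlt := length_flatMap_gt H.ne_nil hi (by cases i <;> simp [middleWord])
        have := hp.2 l hl
        have := hperm.length_eq
        rw [List.length_reverse]
        omega
      · have : 0 ≤ (a - b) * φ := mul_nonneg (by linarith) hφ.le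
        linarith
  rcases le_total b a with h | h
  · exact key hb h (by linarith) hl hn
  · have H := isInduced_swap ha hb
    refine TwoLoops.of_isInduced H (M := ofColumns (0, 1) (1, 0)) (fun i => ?_) ?_
    · cases i <;> simp [swap, vec]
    have H' := isInduced_swap hb ha
    have hl' := H'.run_flatMap hl.2
    exact key ha h (by linarith) (l := l.flatMap fun i => [i.swap]) ⟨H'.flatMap_ne_nil hl.1, hl'⟩
      (by simp [hn])

/-! ### Coordinates with respect to the diagonals, with origin at the top vertex -/

section Coordinates

lemma cos_pi_div_five_eq : Real.cos (Real.pi / 5) = φ / 2 := by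
  rw [Real.cos_pi_div_five, Real.goldenRatio]; ring

lemma sin_pi_div_five_pos : 0 < Real.sin (Real.pi / 5) :=
  Real.sin_pos_of_pos_of_lt_pi (by positivity) (by linarith [Real.pi_pos])

lemma sin_pi_div_five_sq : Real.sin (Real.pi / 5) ^ 2 = 1 - φ ^ 2 / 4 := by
  rw [Real.sin_sq, cos_pi_div_five_eq]; ring

lemma cos_two_pi_div_five : Real.cos (2 * (Real.pi / 5)) = (φ - 1) / 2 := by
  rw [Real.cos_two_mul, cos_pi_div_five_eq, div_pow, Real.goldenRatio_sq]; ring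

lemma sin_two_pi_div_five :
    Real.sin (2 * (Real.pi / 5)) = Real.sin (Real.pi / 5) * φ := by
  rw [Real.sin_two_mul, cos_pi_div_five_eq]; ring

lemma vertex_re (k : ℕ) : (vertex k).re =
    1 / (2 * Real.sin (Real.pi / 5)) * Real.cos (Real.pi / 2 + 2 * Real.pi * k / 5) := by
  rw [vertex, Complex.re_ofReal_mul, Complex.exp_ofReal_mul_I_re]

lemma vertex_im (k : ℕ) : (vertex k).im =
    1 / (2 * Real.sin (Real.pi / 5)) * Real.sin (Real.pi / 2 + 2 * Real.pi * k / 5) := by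
  rw [vertex, Complex.im_ofReal_mul, Complex.exp_ofReal_mul_I_im]

lemma vertex_add_five (k : ℕ) : vertex (k + 5) = vertex k := by
  have h : Real.pi / 2 + 2 * Real.pi * (k + 5 : ℕ) / 5 =
      Real.pi / 2 + 2 * Real.pi * k / 5 + 2 * Real.pi := by push_cast; ring
  apply Complex.ext
  · rw [vertex_re, vertex_re, h, Real.cos_add_two_pi]
  · rw [vertex_im, vertex_im, h, Real.sin_add_two_pi]

/-- The height of the pentagon. -/
noncomputable def height : ℝ := (1 + φ / 2) / (2 * Real.sin (Real.pi / 5))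

lemma height_pos : 0 < height := by
  have := sin_pi_div_five_pos
  have := Real.goldenRatio_pos
  unfold height
  positivity

/-- Identifies the constant of the length formula as the height, by `sin² 36° = 1 - φ² / 4`. -/
lemma height_eq : height = φ ^ 2 * Real.sin (Real.pi / 5) := by
  have hs := sin_pi_div_five_pos
  have h2 := sin_pi_div_five_sq
  have hφ := Real.goldenRatio_sq
  rw [height, div_eq_iff (by positivity)]
  linear_combination (-2 * φ ^ 2) * h2 + (φ ^ 2 / 2 + φ / 2 - 1) * hφ

lemma vertex_zero : vertex 0 = ⟨0, 1 / (2 * Real.sin (Real.pi / 5))⟩ := by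
  apply Complex.ext <;> simp [vertex_re, vertex_im]

lemma vertex_one : vertex 1 = ⟨-φ / 2, (φ - 1) / 2 / (2 * Real.sin (Real.pi / 5))⟩ := by
  have hs := sin_pi_div_five_pos
  have h : Real.pi / 2 + 2 * Real.pi * (1 : ℕ) / 5 = 2 * (Real.pi / 5) + Real.pi / 2 := by
    push_cast; ring
  apply Complex.ext
  · rw [vertex_re, h, Real.cos_add_pi_div_two, sin_two_pi_div_five]
    field_simp
  · rw [vertex_im, h, Real.sin_add_pi_div_two, cos_two_pi_div_five]
    field_simp

lemma vertex_two : vertex 2 = ⟨-1 / 2, -φ / 2 / (2 * Real.sin (Real.pi / 5))⟩ := by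
  have hs := sin_pi_div_five_pos
  have h : Real.pi / 2 + 2 * Real.pi * (2 : ℕ) / 5 = Real.pi - Real.pi / 5 + Real.pi / 2 := by
    push_cast; ring
  apply Complex.ext
  · rw [vertex_re, h, Real.cos_add_pi_div_two, Real.sin_pi_sub]
    field_simp
  · rw [vertex_im, h, Real.sin_add_pi_div_two, Real.cos_pi_sub, cos_pi_div_five_eq]
    field_simp

lemma vertex_three : vertex 3 = ⟨1 / 2, -φ / 2 / (2 * Real.sin (Real.pi / 5))⟩ := by
  have hs := sin_pi_div_five_pos
  have h : Real.pi / 2 + 2 * Real.pi * (3 : ℕ) / 5 = Real.pi / 5 + Real.pi + Real.pi / 2 := by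
    push_cast; ring
  apply Complex.ext
  · rw [vertex_re, h, Real.cos_add_pi_div_two, Real.sin_add_pi]
    field_simp
  · rw [vertex_im, h, Real.sin_add_pi_div_two, Real.cos_add_pi, cos_pi_div_five_eq]
    field_simp

lemma vertex_four : vertex 4 = ⟨φ / 2, (φ - 1) / 2 / (2 * Real.sin (Real.pi / 5))⟩ := by
  have hs := sin_pi_div_five_pos
  have h : Real.pi / 2 + 2 * Real.pi * (4 : ℕ) / 5 =
      2 * Real.pi - 2 * (Real.pi / 5) + Real.pi / 2 := by
    push_cast; ring
  apply Complex.ext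
  · rw [vertex_re, h, Real.cos_add_pi_div_two, Real.sin_two_pi_sub, sin_two_pi_div_five]
    field_simp
  · rw [vertex_im, h, Real.sin_add_pi_div_two, Real.cos_two_pi_sub, cos_two_pi_div_five]
    field_simp

lemma diagU_eq : diagU = ⟨-1 / 2, height⟩ := by
  rw [diagU, vertex_zero, vertex_three]
  apply Complex.ext <;> simp [height] <;> ring

lemma diagV_eq : diagV = ⟨1 / 2, height⟩ := by
  rw [diagV, vertex_zero, vertex_two]
  apply Complex.ext <;> simp [height] <;> ring

/-- The vector with coordinates `p`, `q` with respect to the diagonals. -/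
noncomputable def vect (p q : ℝ) : ℂ := p * diagU + q * diagV

lemma vect_re (p q : ℝ) : (vect p q).re = (q - p) / 2 := by
  simp [vect, diagU_eq, diagV_eq]; ring

lemma vect_im (p q : ℝ) : (vect p q).im = height * (p + q) := by
  simp [vect, diagU_eq, diagV_eq]; ring

lemma vect_inj {p q p' q' : ℝ} : vect p q = vect p' q' ↔ p = p' ∧ q = q' := by
  refine ⟨fun h => ?_, fun h => by rw [h.1, h.2]⟩
  have h1 := congrArg Complex.re h
  have h2 := congrArg Complex.im h
  rw [vect_re, vect_re] at h1
  rw [vect_im, vect_im] at h2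
  have h3 := mul_left_cancel₀ height_pos.ne' h2
  constructor <;> linarith

lemma exists_vect (z : ℂ) : ∃ p q : ℝ, z = vect p q := by
  refine ⟨(z.im / height - 2 * z.re) / 2, (z.im / height + 2 * z.re) / 2, ?_⟩
  have := height_pos
  apply Complex.ext
  · rw [vect_re]; ring
  · rw [vect_im]; field_simp; ring

lemma vect_add (p q p' q' : ℝ) : vect p q + vect p' q' = vect (p + p') (q + q') := by
  simp only [vect]; push_cast; ring

/-- The point whose coordinates with respect to the diagonals and the top vertex are `p`, `q`. -/
noncomputable def pos (p q : ℝ) : ℂ := vertex 0 + vect p q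

lemma pos_inj {p q p' q' : ℝ} : pos p q = pos p' q' ↔ p = p' ∧ q = q' := by
  rw [pos, pos, add_right_inj, vect_inj]

lemma exists_pos (z : ℂ) : ∃ p q : ℝ, z = pos p q := by
  obtain ⟨p, q, h⟩ := exists_vect (z - vertex 0)
  exact ⟨p, q, by rw [pos, ← h]; ring⟩

/-- The coordinates of the vertices of the pentagon. -/
noncomputable def corner : ℕ → ℝ × ℝ
  | 0 => (0, 0)
  | 1 => (φ - 1, -1)
  | 2 => (0, -1)
  | 3 => (-1, 0)
  | 4 => (-1, φ - 1)
  | k + 5 => corner k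

lemma vertex_eq_pos (k : ℕ) : vertex k = pos (corner k).1 (corner k).2 := by
  induction k using Nat.strong_induction_on with
  | _ k ih =>
    have hφ := Real.goldenRatio_sq
    match k with
    | 0 => simp [pos, vect, corner]
    | 1 =>
      rw [pos, vertex_zero, vertex_one]
      apply Complex.ext
      · simp [vect_re, corner]; ring
      · simp only [Complex.add_im, vect_im, corner, height]
        linear_combination (-1 / 2) * (1 / (2 * Real.sin (Real.pi / 5))) * hφ
    | 2 =>
      rw [pos, vect, diagV, corner]; push_cast; ring
    | 3 =>
      rw [pos, vect, diagU, corner]; push_cast; ring1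
    | 4 =>
      rw [pos, vertex_zero, vertex_four]
      apply Complex.ext
      · simp [vect_re, corner]
      · simp only [Complex.add_im, vect_im, corner, height]
        linear_combination (-1 / 2) * (1 / (2 * Real.sin (Real.pi / 5))) * hφ
    | k + 5 => rw [vertex_add_five, ih k (by omega), corner]

end Coordinates

/-! ### The pentagon, its sides and its vertices in coordinates -/

section Pentagon

/-- The pentagon in coordinates. -/
structure Pent (p q : ℝ) : Prop where
  left : -1 ≤ q
  bottom : -1 ≤ p + q
  right : -1 ≤ p
  upLeft : φ * p + q ≤ 0
  upRight : p + φ * q ≤ 0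

lemma pent_corner (k : ℕ) : Pent (corner k).1 (corner k).2 := by
  induction k using Nat.strong_induction_on with
  | _ k ih =>
    have hφ := Real.goldenRatio_sq
    have h1 := Real.one_lt_goldenRatio
    match k with
    | 0 => constructor <;> simp [corner]
    | 1 => constructor <;> simp only [corner] <;> nlinarith
    | 2 => constructor <;> simp only [corner] <;> nlinarith
    | 3 => constructor <;> simp only [corner] <;> nlinarith
    | 4 => constructor <;> simp only [corner] <;> nlinarith
    | k + 5 => exact ih k (by omega)

lemma convex_pent : Convex ℝ {z : ℂ | ∃ p q, z = pos p q ∧ Pent p q} := by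
  rintro _ ⟨p, q, rfl, h⟩ _ ⟨p', q', rfl, h'⟩ a b ha hb hab
  refine ⟨a * p + b * p', a * q + b * q', ?_, ?_⟩
  · have hab' : (a : ℂ) + b = 1 := by exact_mod_cast hab
    simp only [pos, vect, Complex.real_smul]
    push_cast
    linear_combination (vertex 0) * hab'
  · obtain ⟨h1, h2, h3, h4, h5⟩ := h
    obtain ⟨h1', h2', h3', h4', h5'⟩ := h'
    constructor
    · linarith [mul_le_mul_of_nonneg_left h1 ha, mul_le_mul_of_nonneg_left h1' hb]
    · linarith [mul_le_mul_of_nonneg_left h2 ha, mul_le_mul_of_nonneg_left h2' hb]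
    · linarith [mul_le_mul_of_nonneg_left h3 ha, mul_le_mul_of_nonneg_left h3' hb]
    · linarith [mul_le_mul_of_nonneg_left h4 ha, mul_le_mul_of_nonneg_left h4' hb]
    · linarith [mul_le_mul_of_nonneg_left h5 ha, mul_le_mul_of_nonneg_left h5' hb]

lemma pos_mem_of_triangle {K : Set ℂ} (hK : Convex ℝ K) {p q p' q' s t : ℝ}
    (h0 : pos 0 0 ∈ K) (h1 : pos p q ∈ K) (h2 : pos p' q' ∈ K) (hs : 0 ≤ s) (ht : 0 ≤ t)
    (hst : s + t ≤ 1) : pos (s * p + t * p') (s * q + t * q') ∈ K := by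
  have := hK.sum_mem (t := Finset.univ) (w := ![1 - s - t, s, t])
    (z := ![pos 0 0, pos p q, pos p' q'])
    (by intro i _; fin_cases i <;> simp <;> linarith)
    (by simp [Fin.sum_univ_three]; ring) (by intro i _; fin_cases i <;> simpa)
  convert this using 1
  simp only [Fin.sum_univ_three, pos, vect, Complex.real_smul, Matrix.cons_val]
  push_cast
  ring

lemma pos_mem_pentagon {p q : ℝ} : pos p q ∈ pentagon ↔ Pent p q := by
  constructor
  · intro h
    have hsub : pentagon ⊆ {z : ℂ | ∃ p q, z = pos p q ∧ Pent p q} := by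
      refine convexHull_min ?_ convex_pent
      rintro _ ⟨k, rfl⟩
      exact ⟨_, _, vertex_eq_pos k, pent_corner k⟩
    obtain ⟨p', q', h1, h2⟩ := hsub h
    obtain ⟨rfl, rfl⟩ := pos_inj.1 h1
    exact h2
  · rintro ⟨h1, h2, h3, h4, h5⟩
    have hφ := Real.goldenRatio_sq
    have hφ0 := Real.goldenRatio_pos
    have hv : ∀ k, pos (corner k).1 (corner k).2 ∈ pentagon := fun k =>
      subset_convexHull ℝ _ ⟨k, vertex_eq_pos k⟩
    have hK : Convex ℝ pentagon := convex_convexHull ℝ _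
    -- The diagonals from the top vertex cut the pentagon into three triangles, told apart by the
    -- signs of `p` and `q`.
    rcases le_total p 0 with hp | hp
    · rcases le_total q 0 with hq | hq
      · have := pos_mem_of_triangle hK (hv 0) (hv 3) (hv 2) (s := -p) (t := -q)
          (by linarith) (by linarith) (by linarith)
        simpa [corner] using this
      · have := pos_mem_of_triangle hK (hv 0) (hv 4) (hv 3) (s := φ * q) (t := -p - φ * q)
          (by positivity) (by linarith) (by linarith)
        simp only [corner] at this
        convert this using 2 <;> first | ring1 | linear_combination -q * hφ
    · have := pos_mem_of_triangle hK (hv 0) (hv 1) (hv 2) (s := φ * p) (t := -q - φ * p)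
          (by positivity) (by linarith) (by linarith)
      simp only [corner] at this
      convert this using 2 <;> first | ring1 | linear_combination -p * hφ

/-- The point with coordinates `p`, `q` lies on the line through a side. -/
def Tight : Label → ℝ → ℝ → Prop
  | .one, _, q => q = -1
  | .two, p, q => p + φ * q = 0
  | .three, p, q => p + q = -1
  | .four, p, q => φ * p + q = 0
  | .five, p, _ => p = -1

/-- The sides in coordinates. -/
def OnSide (i : Label) (p q : ℝ) : Prop := Pent p q ∧ Tight i p q

/-- The vertices in coordinates. -/
def IsCorner (p q : ℝ) : Prop := ∃ k, corner k = (p, q)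

/-- The sum of the endpoints of a side. -/
noncomputable def mid (i : Label) : ℝ × ℝ := corner i.start + corner (i.start + 1)

lemma mid_one : mid .one = (φ - 1, -2) := by
  simp [mid, Label.start, corner]; norm_num
lemma mid_two : mid .two = (-1, φ - 1) := by
  simp [mid, Label.start, corner]
lemma mid_three : mid .three = (-1, -1) := by
  simp [mid, Label.start, corner]
lemma mid_four : mid .four = (φ - 1, -1) := by
  simp [mid, Label.start, corner]
lemma mid_five : mid .five = (-2, φ - 1) := by
  simp [mid, Label.start, corner]; norm_num

/-- Subtracting from `mid i` is the reflection in the midpoint of side `i`. The pentagon and its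
reflected image lie on opposite sides of the line through that side, so they meet only there. -/
lemma onSide_of_pent {i : Label} {p q : ℝ} (h : Pent p q)
    (h' : Pent ((mid i).1 - p) ((mid i).2 - q)) : OnSide i p q := by
  have hφ := Real.goldenRatio_sq
  refine ⟨h, ?_⟩
  obtain ⟨h1, h2, h3, h4, h5⟩ := h
  obtain ⟨h1', h2', h3', h4', h5'⟩ := h'
  cases i <;> simp only [mid_one, mid_two, mid_three, mid_four, mid_five] at h1' h2' h3' h4' h5' <;>
    simp only [Tight] <;> nlinarith

lemma OnSide.exists_param {i : Label} {p q : ℝ} (h : OnSide i p q) :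
    ∃ t ∈ Set.Icc (0 : ℝ) 1,
      p = (corner i.start).1 + t * ((corner (i.start + 1)).1 - (corner i.start).1) ∧
      q = (corner i.start).2 + t * ((corner (i.start + 1)).2 - (corner i.start).2) := by
  obtain ⟨⟨h1, h2, h3, h4, h5⟩, ht⟩ := h
  have hφ := Real.goldenRatio_sq
  have hφ1 := Real.one_lt_goldenRatio
  cases i <;> simp only [Tight] at ht <;> simp only [Label.start, corner, Set.mem_Icc]
  · exact ⟨1 - φ * p, ⟨by nlinarith, by nlinarith⟩, by linear_combination (-p) * hφ,
      by linear_combination ht⟩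
  · refine ⟨1 + p, ⟨by nlinarith, by nlinarith⟩, by ring, ?_⟩
    linear_combination (φ - 1) * ht - q * hφ
  · exact ⟨-p, ⟨by nlinarith, by nlinarith⟩, by ring, by linear_combination ht⟩
  · refine ⟨φ * p, ⟨by nlinarith, by nlinarith⟩, by linear_combination (-p) * hφ,
      by linear_combination ht⟩
  · exact ⟨φ * q, ⟨by nlinarith, by nlinarith⟩, by linear_combination ht,
      by linear_combination (-q) * hφ⟩

lemma onSide_of_param {i : Label} {t : ℝ} (ht : t ∈ Set.Icc (0 : ℝ) 1) :
    OnSide i ((corner i.start).1 + t * ((corner (i.start + 1)).1 - (corner i.start).1))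
      ((corner i.start).2 + t * ((corner (i.start + 1)).2 - (corner i.start).2)) := by
  have hφ := Real.goldenRatio_sq
  have hφ1 := Real.one_lt_goldenRatio
  constructor
  · have h := convex_pent ⟨_, _, rfl, pent_corner i.start⟩ ⟨_, _, rfl, pent_corner (i.start + 1)⟩
      (sub_nonneg.2 ht.2) ht.1 (by ring)
    obtain ⟨p, q, h1, h2⟩ := h
    have : pos p q = pos ((corner i.start).1 + t * ((corner (i.start + 1)).1 - (corner i.start).1))
      ((corner i.start).2 + t * ((corner (i.start + 1)).2 - (corner i.start).2)) := by
      rw [← h1]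
      simp only [pos, vect, Complex.real_smul]
      push_cast
      ring
    obtain ⟨rfl, rfl⟩ := pos_inj.1 this
    exact h2
  · cases i <;> simp only [Tight, Label.start, corner]
    · ring
    · linear_combination (1 - t) * hφ
    · ring
    · linear_combination t * hφ
    · ring

lemma pos_mem_side {i : Label} {p q : ℝ} : pos p q ∈ side i ↔ OnSide i p q := by
  rw [side, segment_eq_image', vertex_eq_pos, vertex_eq_pos (i.start + 1)]
  have key : ∀ t : ℝ, pos (corner i.start).1 (corner i.start).2 + t •
      (pos (corner (i.start + 1)).1 (corner (i.start + 1)).2 -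
        pos (corner i.start).1 (corner i.start).2) =
      pos ((corner i.start).1 + t * ((corner (i.start + 1)).1 - (corner i.start).1))
      ((corner i.start).2 + t * ((corner (i.start + 1)).2 - (corner i.start).2)) := by
    intro t
    simp only [pos, vect, Complex.real_smul]
    push_cast
    ring
  constructor
  · rintro ⟨t, ht, h⟩
    simp only [key] at h
    obtain ⟨rfl, rfl⟩ := pos_inj.1 h
    exact onSide_of_param ht
  · intro h
    obtain ⟨t, ht, rfl, rfl⟩ := h.exists_param
    exact ⟨t, ht, key t⟩

lemma OnSide.reflect {i : Label} {p q : ℝ} (h : OnSide i p q) :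
    OnSide i ((mid i).1 - p) ((mid i).2 - q) := by
  obtain ⟨t, ht, rfl, rfl⟩ := h.exists_param
  have := onSide_of_param (i := i) (t := 1 - t) ⟨by linarith [ht.2], by linarith [ht.1]⟩
  convert this using 1 <;> simp only [mid, Prod.fst_add, Prod.snd_add] <;> ring

lemma isCorner_iff {p q : ℝ} : IsCorner p q ↔ (p = 0 ∧ q = 0) ∨ (p = φ - 1 ∧ q = -1) ∨
    (p = 0 ∧ q = -1) ∨ (p = -1 ∧ q = 0) ∨ (p = -1 ∧ q = φ - 1) := by
  constructor
  · rintro ⟨k, hk⟩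
    induction k using Nat.strong_induction_on with
    | _ k ih =>
      match k with
      | 0 | 1 | 2 | 3 | 4 => simp [corner, Prod.ext_iff] at hk; simp [← hk.1, ← hk.2]
      | k + 5 => exact ih k (by omega) hk
  · rintro (⟨rfl, rfl⟩ | ⟨rfl, rfl⟩ | ⟨rfl, rfl⟩ | ⟨rfl, rfl⟩ | ⟨rfl, rfl⟩)
    exacts [⟨0, rfl⟩, ⟨1, rfl⟩, ⟨2, rfl⟩, ⟨3, rfl⟩, ⟨4, rfl⟩]

lemma IsCorner.exists_onSide {p q : ℝ} (h : IsCorner p q) : ∃ i, OnSide i p q := by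
  have hφ := Real.goldenRatio_sq
  have hp : Pent p q := by
    obtain ⟨k, hk⟩ := h
    have := pent_corner k
    rwa [hk] at this
  rcases isCorner_iff.1 h with ⟨rfl, rfl⟩ | ⟨rfl, rfl⟩ | ⟨rfl, rfl⟩ | ⟨rfl, rfl⟩ | ⟨rfl, rfl⟩
  · exact ⟨.four, hp, by simp [Tight]⟩
  · exact ⟨.one, hp, by simp [Tight]⟩
  · exact ⟨.one, hp, by simp [Tight]⟩
  · exact ⟨.five, hp, by simp [Tight]⟩
  · exact ⟨.five, hp, by simp [Tight]⟩

lemma isCorner_of_onSide {i j : Label} {p q : ℝ} (hij : i ≠ j) (h : OnSide i p q)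
    (h' : OnSide j p q) : IsCorner p q := by
  rw [isCorner_iff]
  have hφ := Real.goldenRatio_sq
  have hφ1 := Real.one_lt_goldenRatio
  wlog hlt : i.ctorIdx < j.ctorIdx generalizing i j
  · refine this hij.symm h' h ?_
    have : i.ctorIdx ≠ j.ctorIdx := by cases i <;> cases j <;> simp [Label.ctorIdx] at hij ⊢
    omega
  obtain ⟨⟨h1, h2, h3, h4, h5⟩, ht⟩ := h
  obtain ⟨-, ht'⟩ := h'
  cases i <;> cases j <;> simp [Label.ctorIdx] at hlt <;> simp only [Tight] at ht ht'
  · exfalso; nlinarith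
  · exact Or.inr (Or.inr (Or.inl ⟨by linarith, by linarith⟩))
  · exact Or.inr (Or.inl ⟨by subst ht; linear_combination (φ - 1) * ht' - p * hφ, ht⟩)
  · exfalso; nlinarith
  · exfalso; nlinarith
  · refine Or.inl ?_
    have hp : φ * p = 0 := by
      have : q = -(φ * p) := by linarith
      subst this
      linear_combination -ht - p * hφ
    have hp' : p = 0 := by
      rcases mul_eq_zero.1 hp with h | h
      · linarith
      · exact h
    exact ⟨hp', by linarith⟩
  · exact Or.inr (Or.inr (Or.inr (Or.inr ⟨ht', by
      subst ht'; linear_combination (φ - 1) * ht - q * hφ⟩)))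
  · exfalso; nlinarith
  · exact Or.inr (Or.inr (Or.inr (Or.inl ⟨ht', by linarith⟩)))
  · exfalso; nlinarith

lemma IsCorner.reflect {i : Label} {p q : ℝ} (h : IsCorner p q) (hi : OnSide i p q) :
    IsCorner ((mid i).1 - p) ((mid i).2 - q) := by
  have hφ := Real.goldenRatio_sq
  have hφ1 := Real.one_lt_goldenRatio
  obtain ⟨-, hi⟩ := hi
  rw [isCorner_iff]
  rcases isCorner_iff.1 h with ⟨rfl, rfl⟩ | ⟨rfl, rfl⟩ | ⟨rfl, rfl⟩ | ⟨rfl, rfl⟩ | ⟨rfl, rfl⟩ <;>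
  cases i <;> simp only [Tight] at hi <;>
  first
  | (exfalso; nlinarith)
  | (simp only [mid_one, mid_two, mid_three, mid_four, mid_five]; norm_num)

end Pentagon

/-! ### Points of the double pentagon and their identifications -/

lemma sign_mul_self (B : Bool) : sign B * sign B = 1 := by cases B <;> simp [sign]

/-- The point of the copy `B` that corresponds to the point of the pentagon with coordinates
`p`, `q`. -/
noncomputable def copyPos (B : Bool) (p q : ℝ) : ℂ := sign B * pos p q

lemma sign_mul_copyPos (B : Bool) (p q : ℝ) : sign B * copyPos B p q = pos p q := by
  rw [copyPos, ← mul_assoc, sign_mul_self, one_mul]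

lemma copyPos_inj {B : Bool} {p q p' q' : ℝ} :
    copyPos B p q = copyPos B p' q' ↔ p = p' ∧ q = q' := by
  refine ⟨fun h => ?_, fun h => by rw [h.1, h.2]⟩
  rw [← pos_inj, ← sign_mul_copyPos B, h, sign_mul_copyPos]

lemma exists_copyPos (B : Bool) (z : ℂ) : ∃ p q, z = copyPos B p q := by
  obtain ⟨p, q, h⟩ := exists_pos (sign B * z)
  exact ⟨p, q, by rw [copyPos, ← h, ← mul_assoc, sign_mul_self, one_mul]⟩

lemma copyPos_mem {B : Bool} {p q : ℝ} : copyPos B p q ∈ copy B ↔ Pent p q := by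
  rw [copy, Set.mem_ofPred_eq, sign_mul_copyPos, pos_mem_pentagon]

lemma pent_zero : Pent 0 0 := pent_corner 0

open Classical in
/-- The point of the double pentagon given by the point of the copy `B` with coordinates `p`, `q`,
if there is one. -/
noncomputable def pt (B : Bool) (p q : ℝ) : Surface :=
  if h : Pent p q then point B (copyPos B p q) (copyPos_mem.2 h)
  -- Outside the pentagon the value is arbitrary (the top vertex); a total `pt` can be rewritten
  -- without membership proofs.
  else point true (copyPos true 0 0) (copyPos_mem.2 pent_zero)

lemma point_eq_pt {B : Bool} {p q : ℝ} (h : copyPos B p q ∈ copy B) :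
    point B (copyPos B p q) h = pt B p q := by
  rw [pt, dif_pos (copyPos_mem.1 h)]

lemma exists_point_eq {B : Bool} {z : ℂ} (h : z ∈ copy B) :
    ∃ p q, z = copyPos B p q ∧ Pent p q ∧ point B z h = pt B p q := by
  obtain ⟨p, q, rfl⟩ := exists_copyPos B z
  exact ⟨p, q, rfl, copyPos_mem.1 h, point_eq_pt h⟩

lemma vertex_add_vertex (i : Label) :
    vertex i.start + vertex (i.start + 1) = 2 * vertex 0 + vect (mid i).1 (mid i).2 := by
  rw [vertex_eq_pos i.start, vertex_eq_pos (i.start + 1), pos, pos, mid, Prod.fst_add,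
    Prod.snd_add, ← vect_add]
  ring

/-- Both copies carry the coordinates of the one pentagon, the second through `z ↦ -z`. The gluing
translation thereby becomes the reflection in the midpoint of side `i`. -/
lemma pt_glue {B : Bool} {i : Label} {p q : ℝ} (h : OnSide i p q) :
    pt B p q = pt (!B) ((mid i).1 - p) ((mid i).2 - q) := by
  have key : ∀ {p q : ℝ}, OnSide i p q →
      pt true p q = pt false ((mid i).1 - p) ((mid i).2 - q) := by
    intro p q h
    have h' := h.reflect
    rw [pt, dif_pos h.1, pt, dif_pos h'.1]
    refine Quot.sound ⟨i, rfl, rfl, ?_, ?_⟩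
    · simpa [copyPos, sign] using pos_mem_side.2 h
    · rw [vertex_add_vertex]
      simp only [copyPos, sign, pos, vect]
      push_cast
      ring
  cases B
  · have := key h.reflect
    rw [sub_sub_cancel, sub_sub_cancel] at this
    exact this.symm
  · exact key h

/-- Two points of the copies of the pentagon are both vertices, or they are equal, or they are
identified along a side. -/
def SamePoint (B : Bool) (p q : ℝ) (B' : Bool) (p' q' : ℝ) : Prop :=
  (IsCorner p q ∧ IsCorner p' q') ∨ (B = B' ∧ p = p' ∧ q = q') ∨
    (B ≠ B' ∧ ∃ i, OnSide i p q ∧ p' = (mid i).1 - p ∧ q' = (mid i).2 - q)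

lemma SamePoint.symm {B : Bool} {p q : ℝ} {B' : Bool} {p' q' : ℝ}
    (h : SamePoint B p q B' p' q') : SamePoint B' p' q' B p q := by
  rcases h with h | ⟨rfl, rfl, rfl⟩ | ⟨hB, i, hi, rfl, rfl⟩
  · exact Or.inl h.symm
  · exact Or.inr (Or.inl ⟨rfl, rfl, rfl⟩)
  · exact Or.inr (Or.inr ⟨hB.symm, i, hi.reflect, by ring, by ring⟩)

lemma SamePoint.isCorner {B : Bool} {p q : ℝ} {B' : Bool} {p' q' : ℝ}
    (h : SamePoint B p q B' p' q') (hc : IsCorner p q) : IsCorner p' q' := by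
  rcases h with h | ⟨rfl, rfl, rfl⟩ | ⟨hB, i, hi, rfl, rfl⟩
  · exact h.2
  · exact hc
  · exact hc.reflect hi

/-- Away from the vertices a point lies on at most one side, so two successive gluings use the same
side and cancel. At vertices this fails, which is why `SamePoint` relates all of them; only an upper
bound for the generated equivalence is needed. -/
lemma SamePoint.trans {B : Bool} {p q : ℝ} {B' : Bool} {p' q' : ℝ} {B'' : Bool} {p'' q'' : ℝ}
    (h : SamePoint B p q B' p' q') (h' : SamePoint B' p' q' B'' p'' q'') :
    SamePoint B p q B'' p'' q'' := by
  by_cases hc : IsCorner p q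
  · exact Or.inl ⟨hc, h'.isCorner (h.isCorner hc)⟩
  have hc' : ¬IsCorner p' q' := fun h0 => hc (h.symm.isCorner h0)
  rcases h with h | ⟨rfl, rfl, rfl⟩ | ⟨hB, i, hi, rfl, rfl⟩
  · exact absurd h.1 hc
  · exact h'
  rcases h' with h' | ⟨rfl, rfl, rfl⟩ | ⟨hB', j, hj, rfl, rfl⟩
  · exact absurd h'.1 hc'
  · exact Or.inr (Or.inr ⟨hB, i, hi, rfl, rfl⟩)
  · have hij : i = j := by
      by_contra hij
      exact hc' (isCorner_of_onSide hij hi.reflect hj)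
    subst hij
    refine Or.inr (Or.inl ⟨?_, by ring, by ring⟩)
    cases B <;> cases B' <;> cases B'' <;> simp_all

lemma samePoint_of_eqvGen {x y : Pieces} (h : Relation.EqvGen Glue x y) {p q p' q' : ℝ}
    (hx : x.1.2 = copyPos x.1.1 p q) (hy : y.1.2 = copyPos y.1.1 p' q') :
    SamePoint x.1.1 p q y.1.1 p' q' := by
  induction h generalizing p q p' q' with
  | rel x y h =>
    obtain ⟨i, h1, h2, h3, h4⟩ := h
    rw [h1] at hx ⊢
    rw [h2] at hy ⊢
    rw [hx, copyPos, sign, one_mul, pos_mem_side] at h3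
    refine Or.inr (Or.inr ⟨by simp, i, h3, ?_⟩)
    rw [← pos_inj]
    rw [hx, hy, vertex_add_vertex] at h4
    simp only [copyPos, sign, pos, vect] at h4 ⊢
    push_cast
    linear_combination -h4
  | refl x =>
    rw [hx, copyPos_inj] at hy
    exact Or.inr (Or.inl ⟨rfl, hy⟩)
  | symm x y _ ih => exact (ih hy hx).symm
  | trans x y z _ _ ih ih' =>
    obtain ⟨r, s, hr⟩ := exists_copyPos y.1.1 y.1.2
    exact (ih hx hr).trans (ih' hr hy)

lemma samePoint_of_pt_eq {B : Bool} {p q : ℝ} {B' : Bool} {p' q' : ℝ} (h : Pent p q)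
    (h' : Pent p' q') (heq : pt B p q = pt B' p' q') : SamePoint B p q B' p' q' := by
  rw [pt, dif_pos h, pt, dif_pos h'] at heq
  exact samePoint_of_eqvGen (Quot.eqvGen_exact heq) rfl rfl

lemma pt_mem_singular {B : Bool} {p q : ℝ} (h : Pent p q) :
    pt B p q ∈ singular ↔ IsCorner p q := by
  constructor
  · rintro ⟨b, z, hz, heq, k, hk⟩
    obtain ⟨p', q', rfl, h', hpt⟩ := exists_point_eq hz
    rw [hpt] at heq
    rw [sign_mul_copyPos, vertex_eq_pos, pos_inj] at hk
    exact (samePoint_of_pt_eq h h' heq).symm.isCorner ⟨k, by rw [hk.1, hk.2]⟩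
  · rintro ⟨k, hk⟩
    exact ⟨B, copyPos B p q, copyPos_mem.2 h, (point_eq_pt _).symm, k, by
      rw [sign_mul_copyPos, vertex_eq_pos, hk]⟩

lemma pt_mem_sideOn {B : Bool} {i : Label} {p q : ℝ} (h : Pent p q) (hc : ¬IsCorner p q) :
    pt B p q ∈ sideOn i ↔ OnSide i p q := by
  constructor
  · rintro ⟨z, hz, heq, hi⟩
    obtain ⟨p', q', rfl, h', hpt⟩ := exists_point_eq hz
    rw [hpt] at heq
    rw [copyPos, sign, one_mul, pos_mem_side] at hi
    rcases samePoint_of_pt_eq h h' heq with h | ⟨rfl, rfl, rfl⟩ | ⟨hB, j, hj, rfl, rfl⟩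
    · exact absurd h.1 hc
    · exact hi
    · by_cases hij : i = j
      · rwa [hij]
      · have := (isCorner_of_onSide hij hi hj.reflect).reflect hj.reflect
        rw [sub_sub_cancel, sub_sub_cancel] at this
        exact absurd this hc
  · intro hi
    have key : ∀ {p q : ℝ}, OnSide i p q → pt true p q ∈ sideOn i := fun {p q} hi =>
      ⟨copyPos true p q, copyPos_mem.2 hi.1, (point_eq_pt _).symm, by
        rw [copyPos, sign, one_mul, pos_mem_side]; exact hi⟩
    cases B
    · rw [pt_glue hi]
      exact key hi.reflect
    · exact key hi

/-- `1` for the pentagon and `-1` for its copy. -/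
def orient : Bool → ℝ
  | true => 1
  | false => -1

lemma orient_of_ne {B B' : Bool} (h : B ≠ B') : orient B' = -orient B := by
  cases B <;> cases B' <;> simp_all [orient]

lemma sign_eq_orient (B : Bool) : sign B = (orient B : ℂ) := by cases B <;> simp [sign, orient]

lemma orient_mul_self (B : Bool) : orient B * orient B = 1 := by cases B <;> simp [orient]

/-- In these coordinates the flow has velocity `(a, b)` in the pentagon and `-(a, b)` in its copy.
-/
lemma copyPos_add (B : Bool) (p q s a b : ℝ) :
    copyPos B (p + orient B * s * a) (q + orient B * s * b) =
      copyPos B p q + (s : ℂ) * vect a b := by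
  have h : (orient B : ℂ) * orient B = 1 := by exact_mod_cast orient_mul_self B
  simp only [copyPos, pos, vect, sign_eq_orient]
  push_cast
  linear_combination ((s : ℂ) * (a * diagU + b * diagV)) * h

/-! ### Straight curves: uniqueness, concatenation and closing up -/

section Paths

variable {a b : ℝ}

/-- Immediately after time `t`, the curve `f` runs straight in one of the pentagons. -/
def StraightAfter (a b : ℝ) (f : ℝ → Surface) (t : ℝ) : Prop :=
  ∃ ε > 0, ∃ (B : Bool) (p q : ℝ), ∀ s ∈ Set.Ico 0 ε,
    Pent (p + orient B * s * a) (q + orient B * s * b) ∧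
      f (t + s) = pt B (p + orient B * s * a) (q + orient B * s * b)

/-- Immediately before time `t`, the curve `f` runs straight in one of the pentagons. -/
def StraightBefore (a b : ℝ) (f : ℝ → Surface) (t : ℝ) : Prop :=
  ∃ ε > 0, ∃ (B : Bool) (p q : ℝ), ∀ s ∈ Set.Ioc (-ε) 0,
    Pent (p + orient B * s * a) (q + orient B * s * b) ∧
      f (t + s) = pt B (p + orient B * s * a) (q + orient B * s * b)

/-- The curve `f` is straight on the interval from `0` to `T`. -/
structure IsPath (a b : ℝ) (f : ℝ → Surface) (T : ℝ) : Prop where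
  after : ∀ t ∈ Set.Ico 0 T, StraightAfter a b f t
  before : ∀ t ∈ Set.Ioc 0 T, StraightBefore a b f t

lemma isTrajectory_iff {γ : ℝ → Surface} : IsTrajectory (vect a b) γ ↔
    (∀ t, γ t ∉ singular) ∧ (∀ t, StraightAfter a b γ t) ∧ ∀ t, StraightBefore a b γ t := by
  constructor
  · rintro ⟨h1, h2, h3⟩
    refine ⟨h1, fun t => ?_, fun t => ?_⟩
    · obtain ⟨ε, hε, B, τ, h⟩ := h2 t
      obtain ⟨p, q, hpq⟩ := exists_copyPos B (line (vect a b) t - τ)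
      refine ⟨ε, hε, B, p, q, fun s hs => ?_⟩
      obtain ⟨h, heq⟩ := h (t + s) ⟨by linarith [hs.1], by linarith [hs.2]⟩
      have hz : line (vect a b) (t + s) - τ =
          copyPos B (p + orient B * s * a) (q + orient B * s * b) := by
        rw [copyPos_add, ← hpq]; simp only [line]; push_cast; ring
      simp only [hz] at heq h
      exact ⟨copyPos_mem.1 h, heq.trans (point_eq_pt _)⟩
    · obtain ⟨ε, hε, B, τ, h⟩ := h3 t
      obtain ⟨p, q, hpq⟩ := exists_copyPos B (line (vect a b) t - τ)
      refine ⟨ε, hε, B, p, q, fun s hs => ?_⟩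
      obtain ⟨h, heq⟩ := h (t + s) ⟨by linarith [hs.1], by linarith [hs.2]⟩
      have hz : line (vect a b) (t + s) - τ =
          copyPos B (p + orient B * s * a) (q + orient B * s * b) := by
        rw [copyPos_add, ← hpq]; simp only [line]; push_cast; ring
      simp only [hz] at heq h
      exact ⟨copyPos_mem.1 h, heq.trans (point_eq_pt _)⟩
  · rintro ⟨h1, h2, h3⟩
    refine ⟨h1, fun t => ?_, fun t => ?_⟩
    · obtain ⟨ε, hε, B, p, q, h⟩ := h2 t
      refine ⟨ε, hε, B, line (vect a b) t - copyPos B p q, fun s hs => ?_⟩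
      obtain ⟨h, heq⟩ := h (s - t) ⟨by linarith [hs.1], by linarith [hs.2]⟩
      have hz : line (vect a b) s - (line (vect a b) t - copyPos B p q) =
          copyPos B (p + orient B * (s - t) * a) (q + orient B * (s - t) * b) := by
        rw [copyPos_add]; simp only [line]; push_cast; ring
      simp only [hz]
      rw [add_sub_cancel] at heq
      exact ⟨copyPos_mem.2 h, heq.trans (point_eq_pt _).symm⟩
    · obtain ⟨ε, hε, B, p, q, h⟩ := h3 t
      refine ⟨ε, hε, B, line (vect a b) t - copyPos B p q, fun s hs => ?_⟩
      obtain ⟨h, heq⟩ := h (s - t) ⟨by linarith [hs.1], by linarith [hs.2]⟩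
      have hz : line (vect a b) s - (line (vect a b) t - copyPos B p q) =
          copyPos B (p + orient B * (s - t) * a) (q + orient B * (s - t) * b) := by
        rw [copyPos_add]; simp only [line]; push_cast; ring
      simp only [hz]
      rw [add_sub_cancel] at heq
      exact ⟨copyPos_mem.2 h, heq.trans (point_eq_pt _).symm⟩

/-- Two straight motions that agree at one time agree as long as both stay in the pentagons. -/
lemma pt_eq_of_pt_eq {B B' : Bool} {p q p' q' s t : ℝ}
    (hs : Pent (p + orient B * s * a) (q + orient B * s * b))
    (hs' : Pent (p' + orient B' * s * a) (q' + orient B' * s * b))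
    (ht : Pent (p + orient B * t * a) (q + orient B * t * b))
    (ht' : Pent (p' + orient B' * t * a) (q' + orient B' * t * b))
    (hc : pt B (p + orient B * s * a) (q + orient B * s * b) ∉ singular)
    (heq : pt B (p + orient B * s * a) (q + orient B * s * b) =
      pt B' (p' + orient B' * s * a) (q' + orient B' * s * b)) :
    pt B (p + orient B * t * a) (q + orient B * t * b) =
      pt B' (p' + orient B' * t * a) (q' + orient B' * t * b) := by
  rcases samePoint_of_pt_eq hs hs' heq with h | ⟨rfl, h1, h2⟩ | ⟨hB, i, hi, h1, h2⟩
  · exact absurd ((pt_mem_singular hs).2 h.1) hc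
  · obtain rfl : p = p' := by linarith
    obtain rfl : q = q' := by linarith
    rfl
  · have ho := orient_of_ne hB
    have hB' : B' = !B := by cases B <;> cases B' <;> simp_all
    rw [ho] at h1 h2 ht' ⊢
    have h3 : p' + -orient B * t * a = (mid i).1 - (p + orient B * t * a) := by linarith
    have h4 : q' + -orient B * t * b = (mid i).2 - (q + orient B * t * b) := by linarith
    rw [h3, h4] at ht' ⊢
    rw [hB']
    -- The two motions stay reflections of each other. As both are in the pentagon at time `t`, the
    -- point is again on side `i`, and the gluing applies there too.
    exact pt_glue (onSide_of_pent ht ht')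

/-- A straight curve that avoids the singularity is determined by its initial point. -/
lemma IsPath.eq {f g : ℝ → Surface} {T : ℝ} (hf : IsPath a b f T) (hg : IsPath a b g T)
    (h0 : f 0 = g 0) (hns : ∀ t ∈ Set.Ico 0 T, f t ∉ singular) :
    ∀ t ∈ Set.Icc 0 T, f t = g t := by
  by_contra! hcon
  -- Take the infimum of the times of disagreement: straightness before it gives agreement at it,
  -- and straightness after it gives agreement a little beyond, which is absurd.
  set A := {t | t ∈ Set.Icc 0 T ∧ f t ≠ g t}
  have hA : A.Nonempty := hcon
  have hbdd : BddBelow A := ⟨0, fun t ht => ht.1.1⟩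
  obtain ⟨r, hr⟩ := hA
  have hm0 : 0 ≤ sInf A := le_csInf ⟨r, hr⟩ fun t ht => ht.1.1
  have hmr : sInf A ≤ r := csInf_le hbdd hr
  have hlt : ∀ t, 0 ≤ t → t < sInf A → f t = g t := fun t h0 ht => by
    by_contra hne
    exact absurd (csInf_le hbdd ⟨⟨h0, by linarith [hr.1.2]⟩, hne⟩) (not_le.2 ht)
  have hm : f (sInf A) = g (sInf A) := by
    rcases hm0.eq_or_lt with h | h
    · rw [← h, h0]
    · have hmem : sInf A ∈ Set.Ioc 0 T := ⟨h, by linarith [hr.1.2]⟩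
      obtain ⟨ε, hε, B, p, q, hB⟩ := hf.before _ hmem
      obtain ⟨ε', hε', B', p', q', hB'⟩ := hg.before _ hmem
      obtain ⟨δ, hδ0, hδ⟩ := exists_between (lt_min (lt_min hε hε') h)
      rw [lt_min_iff, lt_min_iff] at hδ
      have e1 := hB (-δ) ⟨by linarith, by linarith⟩
      have e1' := hB' (-δ) ⟨by linarith, by linarith⟩
      have e2 := hB 0 ⟨by linarith, le_rfl⟩
      have e2' := hB' 0 ⟨by linarith, le_rfl⟩
      have := pt_eq_of_pt_eq e1.1 e1'.1 e2.1 e2'.1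
        (e1.2 ▸ hns _ ⟨by linarith, by linarith [hmem.2]⟩)
        (by rw [← e1.2, ← e1'.2]; exact hlt _ (by linarith) (by linarith))
      rw [← e2.2, ← e2'.2, add_zero] at this
      exact this
  have hmT : sInf A < T := by
    rcases hmr.eq_or_lt with h | h
    · rw [h] at hm; exact absurd hm hr.2
    · linarith [hr.1.2]
  obtain ⟨ε, hε, B, p, q, hB⟩ := hf.after _ ⟨hm0, hmT⟩
  obtain ⟨ε', hε', B', p', q', hB'⟩ := hg.after _ ⟨hm0, hmT⟩
  have hε2 : 0 < min ε ε' := lt_min hε hε'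
  obtain ⟨t, ht, hlt'⟩ := exists_lt_of_csInf_lt ⟨r, hr⟩ (lt_add_of_pos_right (sInf A) hε2)
  have hmt : sInf A ≤ t := csInf_le hbdd ht
  have e1 := hB 0 ⟨le_rfl, hε⟩
  have e1' := hB' 0 ⟨le_rfl, hε'⟩
  have e2 := hB (t - sInf A) ⟨by linarith, by linarith [min_le_left ε ε']⟩
  have e2' := hB' (t - sInf A) ⟨by linarith, by linarith [min_le_right ε ε']⟩
  have hns' := hns _ ⟨hm0, hmT⟩
  rw [add_zero] at e1 e1'
  have := pt_eq_of_pt_eq e1.1 e1'.1 e2.1 e2'.1 (e1.2 ▸ hns')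
    (by rw [← e1.2, ← e1'.2]; exact hm)
  rw [← e2.2, ← e2'.2, add_sub_cancel] at this
  exact ht.2 this

lemma Pent.segment {p q x y s T : ℝ} (h : Pent p q) (h' : Pent (p + T * x) (q + T * y))
    (hs : s ∈ Set.Icc 0 T) : Pent (p + s * x) (q + s * y) := by
  rcases (hs.1.trans hs.2).eq_or_lt with hT | hT
  · obtain rfl : s = T := by linarith [hs.1, hs.2]
    exact h'
  have hT' := hT.ne'
  obtain ⟨p', q', heq, h1⟩ := convex_pent ⟨_, _, rfl, h⟩ ⟨_, _, rfl, h'⟩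
    (sub_nonneg.2 ((div_le_one hT).2 hs.2)) (div_nonneg hs.1 hT.le) (by ring)
  have h2 : s / T * T = s := div_mul_cancel₀ s hT'
  have : pos p' q' = pos (p + s * x) (q + s * y) := by
    rw [← heq, ← h2, mul_div_assoc, div_self hT']
    simp only [pos, vect, Complex.real_smul]
    push_cast
    ring
  obtain ⟨rfl, rfl⟩ := pos_inj.1 this
  exact h1

lemma isPath_straight {B : Bool} {p q T : ℝ} (h : Pent p q)
    (h' : Pent (p + orient B * T * a) (q + orient B * T * b)) :
    IsPath a b (fun t => pt B (p + orient B * t * a) (q + orient B * t * b)) T := by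
  have key : ∀ s ∈ Set.Icc 0 T, Pent (p + orient B * s * a) (q + orient B * s * b) := by
    intro s hs
    have := Pent.segment (x := orient B * a) (y := orient B * b) h (by convert h' using 1 <;> ring) hs
    convert this using 1 <;> ring
  refine ⟨fun t ht => ⟨T - t, by linarith [ht.2], B, p + orient B * t * a, q + orient B * t * b,
    fun s hs => ?_⟩, fun t ht => ⟨t, ht.1, B, p + orient B * t * a, q + orient B * t * b,
    fun s hs => ?_⟩⟩
  · have e1 : p + orient B * t * a + orient B * s * a = p + orient B * (t + s) * a := by ring
    have e2 : q + orient B * t * b + orient B * s * b = q + orient B * (t + s) * b := by ring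
    rw [e1, e2]
    exact ⟨key _ ⟨by linarith [hs.1, ht.1], by linarith [hs.2]⟩, rfl⟩
  · have e1 : p + orient B * t * a + orient B * s * a = p + orient B * (t + s) * a := by ring
    have e2 : q + orient B * t * b + orient B * s * b = q + orient B * (t + s) * b := by ring
    rw [e1, e2]
    exact ⟨key _ ⟨by linarith [hs.1], by linarith [hs.2, ht.2]⟩, rfl⟩

lemma StraightAfter.congr {f g : ℝ → Surface} {t t' : ℝ} (h : StraightAfter a b f t) {δ : ℝ}
    (hδ : 0 < δ) (hfg : ∀ s ∈ Set.Ico 0 δ, g (t' + s) = f (t + s)) : StraightAfter a b g t' := by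
  obtain ⟨ε, hε, B, p, q, h⟩ := h
  refine ⟨min ε δ, lt_min hε hδ, B, p, q, fun s hs => ?_⟩
  rw [hfg s ⟨hs.1, hs.2.trans_le (min_le_right _ _)⟩]
  exact h s ⟨hs.1, hs.2.trans_le (min_le_left _ _)⟩

lemma StraightBefore.congr {f g : ℝ → Surface} {t t' : ℝ} (h : StraightBefore a b f t) {δ : ℝ}
    (hδ : 0 < δ) (hfg : ∀ s ∈ Set.Ioc (-δ) 0, g (t' + s) = f (t + s)) :
    StraightBefore a b g t' := by
  obtain ⟨ε, hε, B, p, q, h⟩ := h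
  refine ⟨min ε δ, lt_min hε hδ, B, p, q, fun s hs => ?_⟩
  have h1 := min_le_right ε δ
  have h2 := min_le_left ε δ
  rw [hfg s ⟨by linarith [hs.1], hs.2⟩]
  exact h s ⟨by linarith [hs.1], hs.2⟩

/-- Follow `f` up to time `T`, and then `g`. -/
noncomputable def concat (f g : ℝ → Surface) (T t : ℝ) : Surface :=
  if t < T then f t else g (t - T)

lemma concat_of_lt {f g : ℝ → Surface} {T t : ℝ} (h : t < T) : concat f g T t = f t := if_pos h

lemma concat_of_le {f g : ℝ → Surface} {T t : ℝ} (h : T ≤ t) : concat f g T t = g (t - T) :=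
  if_neg h.not_gt

lemma IsPath.concat {f g : ℝ → Surface} {T T' : ℝ} (hf : IsPath a b f T) (hg : IsPath a b g T')
    (h : f T = g 0) : IsPath a b (concat f g T) (T + T') := by
  constructor
  · intro t ht
    rcases lt_or_ge t T with h' | h'
    · exact (hf.after t ⟨ht.1, h'⟩).congr (sub_pos.2 h') fun s hs =>
        concat_of_lt (by linarith [hs.2])
    · exact (hg.after (t - T) ⟨by linarith, by linarith [ht.2]⟩).congr one_pos fun s hs => by
        rw [concat_of_le (by linarith [hs.1])]; congr 1; ring
  · intro t ht
    rcases le_or_gt t T with h' | h'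
    · refine (hf.before t ⟨ht.1, h'⟩).congr one_pos fun s hs => ?_
      rcases lt_or_ge (t + s) T with h2 | h2
      · exact concat_of_lt h2
      · rw [concat_of_le h2]
        have : t + s = T := by linarith [hs.2]
        rw [this, sub_self, h]
    · exact (hg.before (t - T) ⟨by linarith, by linarith [ht.2]⟩).congr (sub_pos.2 h')
        fun s hs => by
          rw [concat_of_le (by linarith [hs.1])]; congr 1; ring

/-- Repeat a closed path periodically by reducing time modulo `T`. -/
lemma IsPath.isTrajectory {f : ℝ → Surface} {T : ℝ} (hf : IsPath a b f T) (hT : 0 < T)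
    (h : f T = f 0) (hns : ∀ t ∈ Set.Ico 0 T, f t ∉ singular) :
    IsTrajectory (vect a b) (fun t => f (toIcoMod hT 0 t)) := by
  have hmem : ∀ t, toIcoMod hT 0 t ∈ Set.Ico 0 T := fun t => by
    simpa using toIcoMod_mem_Ico hT 0 t
  have key : ∀ t s, toIcoMod hT 0 t + s ∈ Set.Ico 0 T →
      toIcoMod hT 0 (t + s) = toIcoMod hT 0 t + s := by
    intro t s hs
    rw [toIcoMod_eq_iff]
    refine ⟨by simpa using hs, toIcoDiv hT 0 t, ?_⟩
    have := toIcoMod_add_toIcoDiv_zsmul hT 0 t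
    rw [add_right_comm, this]
  refine isTrajectory_iff.2 ⟨fun t => hns _ (hmem t), fun t => ?_, fun t => ?_⟩
  · refine (hf.after _ (hmem t)).congr (sub_pos.2 (hmem t).2) fun s hs => ?_
    rw [key t s ⟨by linarith [(hmem t).1, hs.1], by linarith [hs.2]⟩]
  -- At the seam the curve arrives along the end of the path, so straightness before `T` is what is
  -- needed.
  · rcases (hmem t).1.eq_or_lt with h0 | h0
    · refine (hf.before T ⟨hT, le_rfl⟩).congr hT fun s hs => ?_
      rcases hs.2.eq_or_lt with rfl | hs0
      · rw [add_zero, add_zero, ← h0, h]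
      · congr 1
        rw [toIcoMod_eq_iff]
        refine ⟨⟨by linarith [hs.1], by linarith⟩, toIcoDiv hT 0 t - 1, ?_⟩
        have := toIcoMod_add_toIcoDiv_zsmul hT 0 t
        rw [← h0] at this
        rw [sub_smul, one_smul]
        linarith
    · refine (hf.before _ ⟨h0, (hmem t).2.le⟩).congr h0 fun s hs => ?_
      rw [key t s ⟨by linarith [hs.1], by linarith [hs.2, (hmem t).2]⟩]

lemma IsTrajectory.isPath {γ : ℝ → Surface} (h : IsTrajectory (vect a b) γ) (t T : ℝ) :
    IsPath a b (fun s => γ (t + s)) T := by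
  obtain ⟨-, h1, h2⟩ := isTrajectory_iff.1 h
  exact ⟨fun s _ => (h1 (t + s)).congr one_pos fun r _ => by congr 1; ring,
    fun s _ => (h2 (t + s)).congr one_pos fun r _ => by congr 1; ring⟩

end Paths

/-! ### The transversal formed by the sides 4 and 2 -/

namespace Symbol

/-- The first label of a symbol. -/
def first : Symbol → Label
  | I | II => .four
  | III | IV => .two

/-- The second label of a symbol. -/
def second : Symbol → Label
  | I | IV => .three
  | II => .one
  | III => .five

end Symbol

/-- Crossing two sides composes two reflections in midpoints, which is a translation by the
difference of the `mid`s, up to sign. -/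
lemma vec_eq_mid_sub (i : Symbol) : i.vec = mid i.first - mid i.second := by
  cases i <;> simp only [vec, first, second, mid_one, mid_two, mid_three, mid_four, mid_five,
    Prod.mk_sub_mk] <;> norm_num

section Section

variable {a b : ℝ}

/-- The coordinates of the point of the sides `2` and `4` with parameter `s`. -/
noncomputable def sec (a b s : ℝ) : ℝ × ℝ :=
  -- The top vertex has parameter `b - a`; side 2 is below it, side 4 above. The denominators are
  -- the parameter lengths of these sides.
  if s ≤ b - a then
    (-((b - a - s) / (b + a * (φ - 1))), (φ - 1) * ((b - a - s) / (b + a * (φ - 1))))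
  else ((φ - 1) * ((s - b + a) / (a + b * (φ - 1))), -((s - b + a) / (a + b * (φ - 1))))

/-- The point of the sides `2` and `4` with parameter `s`. -/
noncomputable def secPt (a b s : ℝ) : Surface := pt true (sec a b s).1 (sec a b s).2

lemma golden_combination_pos (ha : 0 ≤ a) (hb : 0 ≤ b) (hab : 0 < a + b) :
    0 < b + a * (φ - 1) := by
  have h := Real.one_lt_goldenRatio
  rcases ha.eq_or_lt with rfl | ha
  · linarith
  · nlinarith

/-- The quantity `b * p - a * q` is constant along lines of direction `(a, b)`; the parameter is
this transverse coordinate, shifted by `b - a`. -/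
lemma sec_coord (ha : 0 ≤ a) (hb : 0 ≤ b) (hab : 0 < a + b) (s : ℝ) :
    b * (sec a b s).1 - a * (sec a b s).2 = s - b + a := by
  have h1 := (golden_combination_pos ha hb hab).ne'
  have h2 := (golden_combination_pos hb ha (by linarith)).ne'
  unfold sec
  split_ifs
  · have : (b + a * (φ - 1)) * ((b - a - s) / (b + a * (φ - 1))) = b - a - s :=
      mul_div_cancel₀ _ h1
    linarith
  · have : (a + b * (φ - 1)) * ((s - b + a) / (a + b * (φ - 1))) = s - b + a :=
      mul_div_cancel₀ _ h2
    linarith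

lemma sec_of_onSide (ha : 0 ≤ a) (hb : 0 ≤ b) (hab : 0 < a + b) {p q : ℝ}
    (h : OnSide .four p q ∨ OnSide .two p q) :
    sec a b (b * p - a * q + b - a) = (p, q) := by
  have h1 := golden_combination_pos ha hb hab
  have h2 := golden_combination_pos hb ha (by linarith)
  have hφ := Real.goldenRatio_sq
  have hφ1 := Real.one_lt_goldenRatio
  have two : ∀ {p q : ℝ}, p ≤ 0 → q = -(φ - 1) * p →
      sec a b (b * p - a * q + b - a) = (p, q) := by
    intro p q hp hq
    have hn : b - a - (b * p - a * q + b - a) = -p * (b + a * (φ - 1)) := by rw [hq]; ring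
    have hle : b * p - a * q + b - a ≤ b - a := by nlinarith
    rw [sec, if_pos hle, hn, mul_div_assoc, div_self h1.ne', hq]
    ext <;> simp only <;> ring
  rcases h with ⟨⟨h1', h2', h3', h4', h5'⟩, ht⟩ | ⟨⟨h1', h2', h3', h4', h5'⟩, ht⟩ <;>
    simp only [Tight] at ht
  · obtain rfl : q = -(φ * p) := by linarith
    have hp : 0 ≤ p := by nlinarith
    rcases hp.eq_or_lt with rfl | hp
    · exact two le_rfl (by ring)
    have hn : b * p - a * -(φ * p) + b - a - b + a = φ * p * (a + b * (φ - 1)) := by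
      linear_combination -b * p * hφ
    have hlt : ¬ b * p - a * -(φ * p) + b - a ≤ b - a := by
      have : 0 < φ * p * (a + b * (φ - 1)) := by positivity
      linarith
    rw [sec, if_neg hlt, hn, mul_div_assoc, div_self h2.ne']
    ext <;> simp only
    · linear_combination p * hφ
    · ring
  · exact two (by nlinarith) (by linear_combination (φ - 1) * ht - q * hφ)

lemma onSide_two_sec (ha : 0 ≤ a) (hb : 0 ≤ b) (hab : 0 < a + b) {s : ℝ} (h : -(a * φ) ≤ s)
    (h' : s ≤ b - a) : OnSide .two (sec a b s).1 (sec a b s).2 := by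
  have h1 := golden_combination_pos ha hb hab
  have ht : (b - a - s) / (b + a * (φ - 1)) ∈ Set.Icc (0 : ℝ) 1 :=
    ⟨div_nonneg (by linarith) h1.le, (div_le_one h1).2 (by linarith)⟩
  rw [sec, if_pos h']
  have := onSide_of_param (i := .two) (t := 1 - (b - a - s) / (b + a * (φ - 1)))
    ⟨by linarith [ht.2], by linarith [ht.1]⟩
  simp only [Label.start, corner] at this
  convert this using 1 <;> ring

lemma onSide_four_sec (ha : 0 ≤ a) (hb : 0 ≤ b) (hab : 0 < a + b) {s : ℝ} (h : b - a ≤ s)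
    (h' : s ≤ b * φ) : OnSide .four (sec a b s).1 (sec a b s).2 := by
  have h1 := golden_combination_pos hb ha (by linarith)
  rw [sec]
  split_ifs with hle
  · obtain rfl : s = b - a := le_antisymm hle h
    simpa [Label.start, corner] using onSide_of_param (i := .four) (t := 0) ⟨le_rfl, zero_le_one⟩
  · have := onSide_of_param (i := .four) (t := (s - b + a) / (a + b * (φ - 1)))
      ⟨div_nonneg (by linarith) h1.le, (div_le_one h1).2 (by linarith)⟩
    simp only [Label.start, corner] at this
    convert this using 1 <;> ring

lemma param_of_isCorner_sec (ha : 0 ≤ a) (hb : 0 ≤ b) (hab : 0 < a + b) {s : ℝ}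
    (h : -(a * φ) ≤ s) (h' : s ≤ b * φ) (hc : IsCorner (sec a b s).1 (sec a b s).2) :
    s = -(a * φ) ∨ s = b - a ∨ s = b * φ := by
  have hs := sec_coord ha hb hab s
  have hφ := Real.one_lt_goldenRatio
  have ht : Tight .four (sec a b s).1 (sec a b s).2 ∨ Tight .two (sec a b s).1 (sec a b s).2 := by
    rcases le_total s (b - a) with hle | hle
    · exact Or.inr (onSide_two_sec ha hb hab h hle).2
    · exact Or.inl (onSide_four_sec ha hb hab hle h').2
  rcases isCorner_iff.1 hc with ⟨h1, h2⟩ | ⟨h1, h2⟩ | ⟨h1, h2⟩ | ⟨h1, h2⟩ | ⟨h1, h2⟩ <;>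
    rw [h1, h2] at ht hs
  · right; left; linarith
  · right; right; linarith
  · rcases ht with ht | ht <;> simp only [Tight] at ht <;> exfalso <;> linarith
  · rcases ht with ht | ht <;> simp only [Tight] at ht <;> exfalso <;> linarith
  · left; linarith

lemma isCorner_sec (ha : 0 ≤ a) (hb : 0 ≤ b) (hab : 0 < a + b) {s : ℝ}
    (h : s = -(a * φ) ∨ s = b - a ∨ s = b * φ) : IsCorner (sec a b s).1 (sec a b s).2 := by
  have key : ∀ {p q : ℝ}, IsCorner p q → (OnSide .four p q ∨ OnSide .two p q) →
      s = b * p - a * q + b - a → IsCorner (sec a b s).1 (sec a b s).2 := by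
    intro p q hc ho hs
    rw [hs, sec_of_onSide ha hb hab ho]
    exact hc
  rcases h with rfl | rfl | rfl
  · refine key ⟨4, rfl⟩ (Or.inr ⟨pent_corner 4, ?_⟩) (by ring)
    simp only [Tight]; linear_combination Real.goldenRatio_sq
  · exact key ⟨0, rfl⟩ (Or.inr ⟨pent_corner 0, by simp [Tight]⟩) (by ring)
  · refine key ⟨1, rfl⟩ (Or.inl ⟨pent_corner 1, ?_⟩) (by ring)
    simp only [Tight]; linear_combination Real.goldenRatio_sq

end Section

/-! ### Where a line leaves the pentagon, downwards and upwards -/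

section Exit

variable {a b p q : ℝ}

/-- Let `r` be the time of arrival at the line of side 3. If the point has by then passed `p = -1`
or `q = -1`, it met side 5 or 1 earlier. The recorded positivity says that the motion is not
parallel to that side. -/
lemma exists_exit_down (ha : 0 ≤ a) (hb : 0 ≤ b) (hab : 0 < a + b) (h : Pent p q) :
    ∃ t, 0 ≤ t ∧ (0 < a ∧ OnSide .five (p - t * a) (q - t * b) ∨
      OnSide .three (p - t * a) (q - t * b) ∨ 0 < b ∧ OnSide .one (p - t * a) (q - t * b)) := by
  obtain ⟨h1, h2, h3, h4, h5⟩ := h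
  have hφ := Real.goldenRatio_pos
  have up : ∀ t, 0 ≤ t → φ * (p - t * a) + (q - t * b) ≤ 0 ∧
      (p - t * a) + φ * (q - t * b) ≤ 0 := by
    intro t ht
    have e1 : 0 ≤ t * a := mul_nonneg ht ha
    have e2 : 0 ≤ t * b := mul_nonneg ht hb
    constructor <;> nlinarith
  set r := (p + q + 1) / (a + b)
  have hr : r * (a + b) = p + q + 1 := div_mul_cancel₀ _ hab.ne'
  have hr0 : 0 ≤ r := div_nonneg (by linarith) hab.le
  by_cases hp : -1 ≤ p - r * a
  · by_cases hq : -1 ≤ q - r * b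
    · exact ⟨r, hr0, Or.inr (Or.inl ⟨⟨hq, by linarith, hp, (up r hr0).1, (up r hr0).2⟩, by
        simp only [Tight]; linarith⟩)⟩
    · have hb' : 0 < b := by
        rcases hb.eq_or_lt with rfl | hb
        · exfalso; linarith
        · exact hb
      have ht : (q + 1) / b * b = q + 1 := div_mul_cancel₀ _ hb'.ne'
      have htr : (q + 1) / b ≤ r := by
        by_contra! hlt
        have := mul_lt_mul_of_pos_right hlt hb'
        linarith
      have ht0 : 0 ≤ (q + 1) / b := div_nonneg (by linarith) hb'.le
      have hta := mul_le_mul_of_nonneg_right htr ha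
      exact ⟨(q + 1) / b, ht0, Or.inr (Or.inr ⟨hb', ⟨⟨by linarith, by linarith, by linarith,
        (up _ ht0).1, (up _ ht0).2⟩, by simp only [Tight]; linarith⟩⟩)⟩
  · have ha' : 0 < a := by
      rcases ha.eq_or_lt with rfl | ha
      · exfalso; linarith
      · exact ha
    have ht : (p + 1) / a * a = p + 1 := div_mul_cancel₀ _ ha'.ne'
    have htr : (p + 1) / a ≤ r := by
      by_contra! hlt
      have := mul_lt_mul_of_pos_right hlt ha'
      linarith
    have ht0 : 0 ≤ (p + 1) / a := div_nonneg (by linarith) ha'.le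
    have htb := mul_le_mul_of_nonneg_right htr hb
    exact ⟨(p + 1) / a, ht0, Or.inl ⟨ha', ⟨⟨by linarith, by linarith, by linarith,
      (up _ ht0).1, (up _ ht0).2⟩, by simp only [Tight]; linarith⟩⟩⟩

lemma exists_exit_up (ha : 0 ≤ a) (hb : 0 ≤ b) (hab : 0 < a + b) (h : Pent p q) :
    ∃ t, 0 ≤ t ∧ (OnSide .four (p + t * a) (q + t * b) ∨ OnSide .two (p + t * a) (q + t * b)) := by
  obtain ⟨h1, h2, h3, h4, h5⟩ := h
  have hφ := Real.one_lt_goldenRatio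
  have h6 : 0 < φ * a + b := by nlinarith
  have h7 : 0 < a + φ * b := by nlinarith
  have low : ∀ t, 0 ≤ t → -1 ≤ q + t * b ∧ -1 ≤ p + t * a + (q + t * b) ∧ -1 ≤ p + t * a := by
    intro t ht
    have e1 : 0 ≤ t * a := mul_nonneg ht ha
    have e2 : 0 ≤ t * b := mul_nonneg ht hb
    refine ⟨?_, ?_, ?_⟩ <;> linarith
  set r := -(φ * p + q) / (φ * a + b)
  have hr : r * (φ * a + b) = -(φ * p + q) := div_mul_cancel₀ _ h6.ne'
  have hr0 : 0 ≤ r := div_nonneg (by linarith) h6.le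
  obtain ⟨l1, l2, l3⟩ := low r hr0
  by_cases hp : p + r * a + φ * (q + r * b) ≤ 0
  · exact ⟨r, hr0, Or.inl ⟨⟨l1, l2, l3, by linarith, hp⟩, by simp only [Tight]; linarith⟩⟩
  · set t := -(p + φ * q) / (a + φ * b)
    have ht : t * (a + φ * b) = -(p + φ * q) := div_mul_cancel₀ _ h7.ne'
    have ht0 : 0 ≤ t := div_nonneg (by linarith) h7.le
    have htr : t ≤ r := by
      by_contra! hlt
      have := mul_lt_mul_of_pos_right hlt h7
      linarith
    have := mul_le_mul_of_nonneg_right htr h6.le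
    obtain ⟨l1, l2, l3⟩ := low t ht0
    exact ⟨t, ht0, Or.inr ⟨⟨l1, l2, l3, by linarith, by linarith⟩, by
      simp only [Tight]; linarith⟩⟩

/-- The only danger is running along side 1 or 5, when `b = 0` or `a = 0`; the starting point would
then lie on two sides and be a vertex. -/
lemma not_onSide_down (ha : 0 ≤ a) (hb : 0 ≤ b) (hab : 0 < a + b) {j : Label}
    (hj : j = .four ∨ j = .two) (h : OnSide j p q) (hc : ¬IsCorner p q) {t r : ℝ} (ht : 0 < t)
    (htr : t < r) (hr : Pent (p - r * a) (q - r * b)) (m : Label) :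
    ¬OnSide m (p - t * a) (q - t * b) := by
  rintro ⟨-, hm⟩
  have hφ := Real.one_lt_goldenRatio
  have hne : ∀ m, m ≠ .four → m ≠ .two → ¬OnSide m p q := fun m h4 h2 hm =>
    hc (isCorner_of_onSide (by rcases hj with rfl | rfl <;> assumption) hm h)
  have e1 : 0 ≤ t * a := mul_nonneg ht.le ha
  have e2 : 0 ≤ t * b := mul_nonneg ht.le hb
  have e3 : t * a + t * b < r * a + r * b := by nlinarith
  have e4 : 0 < t * a + t * b := by nlinarith
  obtain ⟨⟨h1, h2, h3, h4, h5⟩, -⟩ := h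
  cases m <;> simp only [Tight] at hm
  · have : b = 0 := by
      by_contra hne
      have := mul_lt_mul_of_pos_right htr (hb.lt_of_ne' hne)
      linarith [hr.left]
    subst this
    exact hne .one (by simp) (by simp) ⟨⟨h1, h2, h3, h4, h5⟩, by simp only [Tight]; linarith⟩
  · nlinarith
  · linarith [hr.bottom]
  · nlinarith
  · have : a = 0 := by
      by_contra hne
      have := mul_lt_mul_of_pos_right htr (ha.lt_of_ne' hne)
      linarith [hr.right]
    subst this
    exact hne .five (by simp) (by simp) ⟨⟨h1, h2, h3, h4, h5⟩, by simp only [Tight]; linarith⟩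

lemma not_onSide_up (ha : 0 ≤ a) (hb : 0 ≤ b) (hab : 0 < a + b) {k : Label}
    (h5 : k = .five → 0 < a) (h1 : k = .one → 0 < b) (h : OnSide k p q) (hc : ¬IsCorner p q)
    {t r : ℝ} (ht : 0 < t) (htr : t < r) (hr : Pent (p + r * a) (q + r * b)) (m : Label) :
    ¬OnSide m (p + t * a) (q + t * b) := by
  rintro ⟨-, hm⟩
  have hφ := Real.one_lt_goldenRatio
  have huniq : ∀ m, OnSide m p q → k = m := fun m hm => by
    by_contra hne
    exact hc (isCorner_of_onSide hne h hm)
  have e1 : t * a ≤ r * a := mul_le_mul_of_nonneg_right htr.le ha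
  have e2 : t * b ≤ r * b := mul_le_mul_of_nonneg_right htr.le hb
  have e3 : t * a + t * b < r * a + r * b := by nlinarith
  have e4 : 0 < t * a + t * b := by nlinarith
  have hP := h.1
  cases m <;> simp only [Tight] at hm
  · have : b = 0 := by
      by_contra hne
      have := mul_pos ht (hb.lt_of_ne' hne)
      linarith [hP.left]
    subst this
    exact (h1 (huniq _ ⟨hP, by simp only [Tight]; linarith⟩)).false
  · nlinarith [hr.upRight]
  · linarith [hP.bottom]
  · nlinarith [hr.upLeft]
  · have : a = 0 := by
      by_contra hne
      have := mul_pos ht (ha.lt_of_ne' hne)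
      linarith [hP.right]
    subst this
    exact (h5 (huniq _ ⟨hP, by simp only [Tight]; linarith⟩)).false

end Exit

/-! ### Realizing a step of the exchange by a piece of trajectory -/

section Legs

variable {a b : ℝ}

/-- The curve `f` runs straight from the point of the section with parameter `s` through one copy
and then the other to the point with parameter `s'`, and meets the sides only at the times `0`
and `τ₁`. -/
structure IsLeg (a b : ℝ) (i : Symbol) (s s' : ℝ) (f : ℝ → Surface) (τ₁ τ : ℝ) : Prop where
  pos : 0 < τ₁
  lt : τ₁ < τ
  isPath : IsPath a b f τ
  start : f 0 = secPt a b s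
  finish : f τ = secPt a b s'
  nonsingular : ∀ t ∈ Set.Ico 0 τ, f t ∉ singular
  mem_sideOn : ∀ t ∈ Set.Ico 0 τ, ∀ m, f t ∈ sideOn m ↔
    (t = 0 ∧ m = i.first) ∨ (t = τ₁ ∧ m = i.second)
  fst_eq : τ * a = i.vec.1 + (sec a b s').1 - (sec a b s).1
  snd_eq : τ * b = i.vec.2 + (sec a b s').2 - (sec a b s).2

lemma first_eq (i : Symbol) : i.first = .four ∨ i.first = .two := by cases i <;> simp [first]

lemma second_ne (i : Symbol) : i.second ≠ .four ∧ i.second ≠ .two := by cases i <;> simp [second]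

lemma OnSide.eq {j k : Label} {p q : ℝ} (h : OnSide j p q) (hc : ¬IsCorner p q)
    (h' : OnSide k p q) : j = k := by
  by_contra hne
  exact hc (isCorner_of_onSide hne h h')

lemma OnSide.not_isCorner_reflect {i : Label} {p q : ℝ} (h : OnSide i p q) (hc : ¬IsCorner p q) :
    ¬IsCorner ((mid i).1 - p) ((mid i).2 - q) := fun h' => hc <| by
  simpa using h'.reflect h.reflect

/-- The leg is a downward segment `f₁` in the copy followed by an upward segment `f₂` in the
pentagon, glued along side `i.second`. -/
lemma exists_isLeg_of_exit (ha : 0 ≤ a) (hb : 0 ≤ b) (hab : 0 < a + b) {i : Symbol} {s p q t₁ : ℝ}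
    (hs : OnSide i.first (sec a b s).1 (sec a b s).2)
    (hsc : ¬IsCorner (sec a b s).1 (sec a b s).2)
    (hp : p = (mid i.first).1 - (sec a b s).1 - t₁ * a)
    (hq : q = (mid i.first).2 - (sec a b s).2 - t₁ * b) (ht₁ : 0 ≤ t₁)
    (h : OnSide i.second p q) (hc : ¬IsCorner p q) (h5 : i.second = .five → 0 < a)
    (h1 : i.second = .one → 0 < b) :
    ∃ f τ₁ τ, IsLeg a b i s (s - b * i.vec.1 + a * i.vec.2) f τ₁ τ := by
  obtain ⟨hs4, hs2⟩ := second_ne i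
  have hs' := hs.reflect
  have hsc' := hs.not_isCorner_reflect hsc
  have hne : i.first ≠ i.second := by rcases first_eq i with h | h <;> rw [h] <;> tauto
  have ht₁' : 0 < t₁ := ht₁.lt_of_ne <| by
    rintro rfl
    rw [zero_mul, sub_zero] at hp hq
    subst hp hq
    exact hc (isCorner_of_onSide hne hs' h)
  have h' := h.reflect
  have hc' := h.not_isCorner_reflect hc
  obtain ⟨t₂, ht₂, hup⟩ := exists_exit_up ha hb hab h'.1
  have hP : Pent ((mid i.second).1 - p + t₂ * a) ((mid i.second).2 - q + t₂ * b) := by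
    rcases hup with h | h <;> exact h.1
  have ht₂' : 0 < t₂ := ht₂.lt_of_ne <| by
    rintro rfl
    rw [zero_mul, zero_mul, add_zero, add_zero] at hup
    rcases hup with h | h
    · exact hs4 (h'.eq hc' h)
    · exact hs2 (h'.eq hc' h)
  have hsec := sec_of_onSide ha hb hab hup
  have hcoord := sec_coord ha hb hab s
  have hvec := vec_eq_mid_sub i
  have hv1 : i.vec.1 = (mid i.first).1 - (mid i.second).1 := by rw [hvec]; rfl
  have hv2 : i.vec.2 = (mid i.first).2 - (mid i.second).2 := by rw [hvec]; rfl
  have hpar : b * ((mid i.second).1 - p + t₂ * a) - a * ((mid i.second).2 - q + t₂ * b) + b - a =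
      s - b * i.vec.1 + a * i.vec.2 := by
    rw [hp, hq, hv1, hv2]; linarith
  rw [hpar] at hsec
  have hgl : pt false p q = pt true ((mid i.second).1 - p) ((mid i.second).2 - q) := pt_glue h
  set f₁ : ℝ → Surface := fun t => pt false ((mid i.first).1 - (sec a b s).1 + orient false * t * a)
    ((mid i.first).2 - (sec a b s).2 + orient false * t * b) with hf₁
  set f₂ : ℝ → Surface := fun t => pt true ((mid i.second).1 - p + orient true * t * a)
    ((mid i.second).2 - q + orient true * t * b) with hf₂
  have ho : ∀ x t c : ℝ, x + orient false * t * c = x - t * c := by intros; simp [orient]; ring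
  have ho' : ∀ x t c : ℝ, x + orient true * t * c = x + t * c := by intros; simp [orient]
  simp only [ho] at hf₁
  simp only [ho'] at hf₂
  have hf₁t : ∀ t, f₁ t = pt false ((mid i.first).1 - (sec a b s).1 - t * a)
    ((mid i.first).2 - (sec a b s).2 - t * b) := fun t => by rw [hf₁]
  have hf₂t : ∀ t, f₂ t = pt true ((mid i.second).1 - p + t * a)
    ((mid i.second).2 - q + t * b) := fun t => by rw [hf₂]
  have hpath₁ : IsPath a b f₁ t₁ := isPath_straight hs'.1 (by rw [ho, ho, ← hp, ← hq]; exact h.1)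
  have hpath₂ : IsPath a b f₂ t₂ := isPath_straight h'.1 (by rw [ho', ho']; exact hP)
  have side₁ : ∀ t ∈ Set.Ico 0 t₁, ∃ p q, f₁ t = pt false p q ∧ Pent p q ∧ ¬IsCorner p q ∧
      ∀ m, OnSide m p q ↔ t = 0 ∧ m = i.first := by
    intro t ht
    refine ⟨_, _, hf₁t t, ?_⟩
    rcases ht.1.eq_or_lt with rfl | h0
    · rw [zero_mul, zero_mul, sub_zero, sub_zero]
      exact ⟨hs'.1, hsc', fun m => ⟨fun hm => ⟨rfl, hm.eq hsc' hs'⟩, fun hm => hm.2 ▸ hs'⟩⟩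
    · have hnot := not_onSide_down ha hb hab (first_eq i) hs' hsc' h0 ht.2
        (by rw [← hp, ← hq]; exact h.1)
      refine ⟨?_, fun hcor => ?_, fun m => iff_of_false (hnot m) fun hm => h0.ne' hm.1⟩
      · have := Pent.segment (x := -a) (y := -b) (T := t₁) hs'.1
          (by convert h.1 using 1 <;> simp only [hp, hq] <;> ring) ⟨ht.1, ht.2.le⟩
        convert this using 1 <;> ring
      · obtain ⟨m, hm⟩ := hcor.exists_onSide
        exact hnot m hm
  have side₂ : ∀ t ∈ Set.Ico 0 t₂, ∃ p q, f₂ t = pt true p q ∧ Pent p q ∧ ¬IsCorner p q ∧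
      ∀ m, OnSide m p q ↔ t = 0 ∧ m = i.second := by
    intro t ht
    refine ⟨_, _, hf₂t t, ?_⟩
    rcases ht.1.eq_or_lt with rfl | h0
    · rw [zero_mul, zero_mul, add_zero, add_zero]
      exact ⟨h'.1, hc', fun m => ⟨fun hm => ⟨rfl, hm.eq hc' h'⟩, fun hm => hm.2 ▸ h'⟩⟩
    · have hnot := not_onSide_up ha hb hab h5 h1 h' hc' h0 ht.2 hP
      refine ⟨h'.1.segment hP ⟨ht.1, ht.2.le⟩, fun hcor => ?_,
        fun m => iff_of_false (hnot m) fun hm => h0.ne' hm.1⟩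
      obtain ⟨m, hm⟩ := hcor.exists_onSide
      exact hnot m hm
  refine ⟨concat f₁ f₂ t₁, t₁, t₁ + t₂, ht₁', by linarith, hpath₁.concat hpath₂ ?_, ?_, ?_, ?_,
    ?_, ?_, ?_⟩
  · rw [hf₁t, hf₂t, ← hp, ← hq, hgl]; simp
  · rw [concat_of_lt ht₁', hf₁t, secPt, pt_glue hs]; simp
  · rw [concat_of_le (by linarith), hf₂t, secPt, hsec]; simp
  · intro t ht
    rcases lt_or_ge t t₁ with hlt | hle
    · obtain ⟨p, q, h1, h2, h3, -⟩ := side₁ t ⟨ht.1, hlt⟩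
      rwa [concat_of_lt hlt, h1, pt_mem_singular h2]
    · obtain ⟨p, q, h1, h2, h3, -⟩ := side₂ (t - t₁) ⟨by linarith, by linarith [ht.2]⟩
      rwa [concat_of_le hle, h1, pt_mem_singular h2]
  · intro t ht m
    rcases lt_or_ge t t₁ with hlt | hle
    · obtain ⟨p, q, h1, h2, h3, h4⟩ := side₁ t ⟨ht.1, hlt⟩
      rw [concat_of_lt hlt, h1, pt_mem_sideOn h2 h3, h4, or_iff_left fun h => hlt.ne h.1]
    · obtain ⟨p, q, h1, h2, h3, h4⟩ := side₂ (t - t₁) ⟨by linarith, by linarith [ht.2]⟩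
      rw [concat_of_le hle, h1, pt_mem_sideOn h2 h3, h4, or_iff_right (fun h => by
        linarith [h.1]), sub_eq_zero]
  · rw [hsec, hv1]; linarith
  · rw [hsec, hv2]; linarith

lemma Step.eq {i : Symbol} {s s' : ℝ} (h : Step a b i s s') :
    s' = s - b * i.vec.1 + a * i.vec.2 := by
  cases i <;> simp only [Step] at h <;> obtain ⟨-, -, rfl⟩ := h <;> simp [vec]

lemma Step.onSide_sec (ha : 0 ≤ a) (hb : 0 ≤ b) (hab : 0 < a + b) {i : Symbol} {s s' : ℝ}
    (h : Step a b i s s') : OnSide i.first (sec a b s).1 (sec a b s).2 := by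
  have := le_mul_golden ha
  have := le_mul_golden hb
  cases i <;> simp only [Step] at h <;> obtain ⟨h1, h2, -⟩ := h
  · exact onSide_four_sec ha hb hab (by linarith) (by linarith)
  · exact onSide_four_sec ha hb hab (by linarith) (by linarith)
  · exact onSide_two_sec ha hb hab (by linarith) (by linarith)
  · exact onSide_two_sec ha hb hab (by linarith) (by linarith)

lemma Step.not_isCorner_sec (ha : 0 ≤ a) (hb : 0 ≤ b) (hab : 0 < a + b) {i : Symbol} {s s' : ℝ}
    (h : Step a b i s s') : ¬IsCorner (sec a b s).1 (sec a b s).2 := by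
  intro hc
  have := le_mul_golden ha
  have := le_mul_golden hb
  have hmem := (h.mem ha hb).1
  rcases param_of_isCorner_sec ha hb hab hmem.1.le hmem.2.le hc with rfl | rfl | rfl
  · exact hmem.1.false
  · cases i <;> simp only [Step] at h <;> obtain ⟨h1, h2, -⟩ := h <;> linarith
  · exact hmem.2.false

/-- The transverse coordinate, conserved on the way down, decides the exit side: the interval of `i`
is exactly what puts it strictly inside the range of side `i.second`. -/
lemma Step.exists_isLeg (ha : 0 ≤ a) (hb : 0 ≤ b) (hab : 0 < a + b) {i : Symbol} {s s' : ℝ}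
    (h : Step a b i s s') : ∃ f τ₁ τ, IsLeg a b i s s' f τ₁ τ := by
  have hon := h.onSide_sec ha hb hab
  have hnc := h.not_isCorner_sec ha hb hab
  have hcoord := sec_coord ha hb hab s
  have ha1 := le_mul_golden ha
  have hb1 := le_mul_golden hb
  have hφ := Real.one_lt_goldenRatio
  obtain ⟨t, ht, hexit⟩ := exists_exit_down ha hb hab hon.reflect.1
  set p := (mid i.first).1 - (sec a b s).1 - t * a with hp
  set q := (mid i.first).2 - (sec a b s).2 - t * b with hq
  have hκ : b * p - a * q = b * (mid i.first).1 - a * (mid i.first).2 - (s - b + a) := by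
    rw [hp, hq]; linarith
  rw [h.eq]
  suffices hsuff : OnSide i.second p q ∧ ¬IsCorner p q ∧ (i.second = .five → 0 < a) ∧
      (i.second = .one → 0 < b) from
    exists_isLeg_of_exit ha hb hab hon hnc hp hq ht hsuff.1 hsuff.2.1 hsuff.2.2.1 hsuff.2.2.2
  clear_value p q
  -- The transverse coordinates of the five vertices; the exit point is not a vertex because its
  -- coordinate avoids these.
  have hcor : IsCorner p q → b * p - a * q = b - a - (b - a) ∨ b * p - a * q = b * φ - b + a ∨
      b * p - a * q = a ∨ b * p - a * q = -b ∨ b * p - a * q = -b - (a * φ - a) := by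
    intro hc
    rcases isCorner_iff.1 hc with ⟨rfl, rfl⟩ | ⟨rfl, rfl⟩ | ⟨rfl, rfl⟩ | ⟨rfl, rfl⟩ | ⟨rfl, rfl⟩
    · left; ring
    · right; left; ring
    · right; right; left; ring
    · right; right; right; left; ring
    · right; right; right; right; ring
  have hrange : (0 < a ∧ OnSide .five p q ∧ -b - (a * φ - a) ≤ b * p - a * q ∧
        b * p - a * q ≤ -b) ∨
      (OnSide .three p q ∧ -b ≤ b * p - a * q ∧ b * p - a * q ≤ a) ∨
      (0 < b ∧ OnSide .one p q ∧ a ≤ b * p - a * q ∧ b * p - a * q ≤ b * φ - b + a) := by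
    have hφ2 := Real.goldenRatio_sq
    rcases hexit with ⟨h0, hh⟩ | hh | ⟨h0, hh⟩
    · obtain ⟨u, ⟨hu0, hu1⟩, rfl, rfl⟩ := hh.exists_param
      refine Or.inl ⟨h0, hh, ?_, ?_⟩ <;> simp only [Label.start, corner] <;>
        nlinarith [mul_nonneg (sub_nonneg.2 hu1) (mul_nonneg ha (sub_nonneg.2 hφ.le)),
          mul_nonneg hu0 (mul_nonneg ha (sub_nonneg.2 hφ.le))]
    · obtain ⟨u, ⟨hu0, hu1⟩, rfl, rfl⟩ := hh.exists_param
      refine Or.inr (Or.inl ⟨hh, ?_, ?_⟩) <;> simp only [Label.start, corner] <;> nlinarith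
    · obtain ⟨u, ⟨hu0, hu1⟩, rfl, rfl⟩ := hh.exists_param
      refine Or.inr (Or.inr ⟨h0, hh, ?_, ?_⟩) <;> simp only [Label.start, corner] <;>
        nlinarith [mul_nonneg (sub_nonneg.2 hu1) (mul_nonneg hb (sub_nonneg.2 hφ.le)),
          mul_nonneg hu0 (mul_nonneg hb (sub_nonneg.2 hφ.le))]
  cases i <;> simp only [Step, first, second, mid_four, mid_two] at h hκ ⊢ <;>
    obtain ⟨h1, h2, -⟩ := h
  · rcases hrange with ⟨-, -, e1, e2⟩ | ⟨hh, e1, e2⟩ | ⟨-, -, e1, e2⟩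
    · exfalso; linarith
    · exact ⟨hh, fun hc => by rcases hcor hc with e | e | e | e | e <;> linarith, by simp, by simp⟩
    · exfalso; linarith
  · rcases hrange with ⟨-, -, e1, e2⟩ | ⟨hh, e1, e2⟩ | ⟨h0, hh, e1, e2⟩
    · exfalso; linarith
    · exfalso; linarith
    · exact ⟨hh, fun hc => by rcases hcor hc with e | e | e | e | e <;> linarith, by simp, by simpa⟩
  · rcases hrange with ⟨h0, hh, e1, e2⟩ | ⟨hh, e1, e2⟩ | ⟨h0, -, e1, e2⟩
    · exact ⟨hh, fun hc => by rcases hcor hc with e | e | e | e | e <;> linarith, by simpa, by simp⟩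
    · exfalso; linarith
    · exfalso; linarith
  · rcases hrange with ⟨-, -, e1, e2⟩ | ⟨hh, e1, e2⟩ | ⟨-, -, e1, e2⟩
    · exfalso; linarith
    · exact ⟨hh, fun hc => by rcases hcor hc with e | e | e | e | e <;> linarith, by simp, by simp⟩
    · exfalso; linarith

end Legs

/-! ### Periodic orbits and primitive loops -/

section Trajectories

variable {a b : ℝ} {γ : ℝ → Surface}

lemma IsTrajectory.follow (h : IsTrajectory (vect a b) γ) {B : Bool} {p q t T : ℝ}
    (hγ : γ t = pt B p q) (hP : Pent p q) (hT : 0 ≤ T)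
    (hP' : Pent (p + orient B * T * a) (q + orient B * T * b)) :
    γ (t + T) = pt B (p + orient B * T * a) (q + orient B * T * b) :=
  (h.isPath t T).eq (isPath_straight hP hP') (by simpa using hγ)
    (fun _ _ => h.nonsingular _) T ⟨hT, le_rfl⟩

/-- The values `-b` and `a` are the transverse coordinates of the right and left ends of the bottom
side. -/
lemma isCorner_of_exit (hab : 0 < a + b) {p q : ℝ}
    (h : 0 < a ∧ OnSide .five p q ∨ OnSide .three p q ∨ 0 < b ∧ OnSide .one p q)
    (hκ : b * p - a * q = -b ∨ b * p - a * q = a) : IsCorner p q := by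
  have hφ : 0 < φ - 1 := sub_pos.2 Real.one_lt_goldenRatio
  rcases h with ⟨h0, hh⟩ | hh | ⟨h0, hh⟩ <;>
    obtain ⟨u, ⟨hu0, hu1⟩, rfl, rfl⟩ := hh.exists_param <;>
    simp only [Label.start, corner] at hκ ⊢ <;> rw [isCorner_iff]
  · have e := mul_nonneg hu0 (mul_pos h0 hφ).le
    have hu : u = 0 := by
      have e' : u * (a * (φ - 1)) = 0 := by rcases hκ with h | h <;> linarith
      exact (mul_eq_zero.1 e').resolve_right (mul_pos h0 hφ).ne'
    right; right; right; left
    rw [hu]; constructor <;> ring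
  · rcases hκ with h | h
    · have e' : (1 - u) * (a + b) = 0 := by linarith
      have hu : u = 1 := by linarith [(mul_eq_zero.1 e').resolve_right hab.ne']
      right; right; right; left
      rw [hu]; constructor <;> ring
    · have e' : u * (a + b) = 0 := by linarith
      have hu : u = 0 := (mul_eq_zero.1 e').resolve_right hab.ne'
      right; right; left
      rw [hu]; constructor <;> ring
  · have e := mul_nonneg (sub_nonneg.2 hu1) (mul_pos h0 hφ).le
    have hu : u = 1 := by
      have e' : (1 - u) * (b * (φ - 1)) = 0 := by rcases hκ with h | h <;> linarith
      linarith [(mul_eq_zero.1 e').resolve_right (mul_pos h0 hφ).ne']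
    right; right; left
    rw [hu]; constructor <;> ring

lemma pent_sec (ha : 0 ≤ a) (hb : 0 ≤ b) (hab : 0 < a + b) {s : ℝ}
    (hs : s ∈ Set.Icc (-(a * φ)) (b * φ)) : Pent (sec a b s).1 (sec a b s).2 := by
  rcases le_total s (b - a) with h | h
  · exact (onSide_two_sec ha hb hab hs.1 h).1
  · exact (onSide_four_sec ha hb hab h hs.2).1

/-- The parameters outside the four open intervals are the vertices of the transversal and the two
points that flow into an end of the bottom side. A trajectory avoids them all. -/
lemma IsTrajectory.exists_step (ha : 0 ≤ a) (hb : 0 ≤ b) (hab : 0 < a + b)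
    (h : IsTrajectory (vect a b) γ) {t s : ℝ} (hs : s ∈ Set.Icc (-(a * φ)) (b * φ))
    (hγ : γ t = secPt a b s) : ∃ i s', Step a b i s s' := by
  have hP := pent_sec ha hb hab hs
  have hc : ¬IsCorner (sec a b s).1 (sec a b s).2 := fun hc =>
    h.nonsingular t (hγ ▸ (pt_mem_singular hP).2 hc)
  have hmid : s ≠ b - a := fun e => hc (isCorner_sec ha hb hab (Or.inr (Or.inl e)))
  have hlo : -(a * φ) < s := hs.1.lt_of_ne fun e =>
    hc (isCorner_sec ha hb hab (Or.inl e.symm))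
  have hhi : s < b * φ := hs.2.lt_of_ne fun e => hc (isCorner_sec ha hb hab (Or.inr (Or.inr e)))
  have hcoord := sec_coord ha hb hab s
  have hit : ∀ j, OnSide j (sec a b s).1 (sec a b s).2 →
      ¬ (b * (mid j).1 - a * (mid j).2 - (s - b + a) = -b ∨
        b * (mid j).1 - a * (mid j).2 - (s - b + a) = a) := by
    intro j hj hκ
    obtain ⟨T, hT, hexit⟩ := exists_exit_down ha hb hab hj.reflect.1
    have hcor := isCorner_of_exit hab hexit (by
      convert hκ using 2 <;> linarith)
    have hP' : Pent ((mid j).1 - (sec a b s).1 - T * a) ((mid j).2 - (sec a b s).2 - T * b) := by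
      rcases hexit with ⟨-, h⟩ | h | ⟨-, h⟩ <;> exact h.1
    have e1 : ∀ x c : ℝ, x + orient (!true) * T * c = x - T * c := by intros; simp [orient]; ring
    have hf := h.follow (T := T) (hγ.trans (pt_glue hj)) hj.reflect.1 hT (by rwa [e1, e1])
    rw [e1, e1] at hf
    exact h.nonsingular _ (hf ▸ (pt_mem_singular hP').2 hcor)
  rcases hmid.lt_or_gt with hlt | hlt
  · have hj := onSide_two_sec ha hb hab hs.1 hlt.le
    rcases lt_trichotomy s (b - a * φ) with h1 | h1 | h1
    · exact ⟨IV, _, hlo, h1, rfl⟩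
    · exact absurd (Or.inl (by rw [h1, mid_two]; ring)) (hit .two hj)
    · exact ⟨III, _, h1, hlt, rfl⟩
  · have hj := onSide_four_sec ha hb hab hlt.le hs.2
    rcases lt_trichotomy s (b * φ - a) with h1 | h1 | h1
    · exact ⟨II, _, hlt, h1, rfl⟩
    · exact absurd (Or.inr (by rw [h1, mid_four]; ring)) (hit .four hj)
    · exact ⟨I, _, h1, hhi, rfl⟩

lemma IsTrajectory.exists_secPt (ha : 0 ≤ a) (hb : 0 ≤ b) (hab : 0 < a + b)
    (h : IsTrajectory (vect a b) γ) :
    ∃ t, ∃ s ∈ Set.Icc (-(a * φ)) (b * φ), γ t = secPt a b s := by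
  have up : ∀ {t p q}, Pent p q → γ t = pt true p q →
      ∃ t, ∃ s ∈ Set.Icc (-(a * φ)) (b * φ), γ t = secPt a b s := by
    intro t p q hP hγ
    obtain ⟨T, hT, hexit⟩ := exists_exit_up ha hb hab hP
    have hP' : Pent (p + T * a) (q + T * b) := by rcases hexit with h | h <;> exact h.1
    have e1 : ∀ x c : ℝ, x + orient true * T * c = x + T * c := by intros; simp [orient]
    have hf := h.follow (T := T) hγ hP hT (by rwa [e1, e1])
    rw [e1, e1] at hf
    have hsec := sec_of_onSide ha hb hab hexit
    refine ⟨t + T, _, ?_, by rw [hf, secPt, hsec]⟩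
    have hφ := Real.goldenRatio_sq
    have hφ1 : 0 < φ - 1 := sub_pos.2 Real.one_lt_goldenRatio
    have key : ∀ {p q}, OnSide .four p q ∨ OnSide .two p q →
        b * p - a * q + b - a ∈ Set.Icc (-(a * φ)) (b * φ) := by
      intro p q hpq
      rcases hpq with hh | hh <;> obtain ⟨u, ⟨hu0, hu1⟩, rfl, rfl⟩ := hh.exists_param <;>
        simp only [Label.start, corner, Set.mem_Icc] <;>
        have e1 := mul_nonneg ha hu0 <;> have e2 := mul_nonneg hb hu0 <;>
        have e3 := mul_nonneg ha (sub_nonneg.2 hu1) <;>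
        have e4 := mul_nonneg hb (sub_nonneg.2 hu1) <;>
        have e5 := mul_nonneg e1 hφ1.le <;> have e6 := mul_nonneg e2 hφ1.le <;>
        have e7 := mul_nonneg e3 hφ1.le <;> have e8 := mul_nonneg e4 hφ1.le <;>
        have e9 := mul_nonneg ha hφ1.le <;> have e10 := mul_nonneg hb hφ1.le <;>
        constructor <;> linarith
    exact key hexit
  obtain ⟨ε, hε, B, p, q, h0⟩ := (isTrajectory_iff.1 h).2.1 0
  have h0 := h0 0 ⟨le_rfl, hε⟩
  simp only [mul_zero, zero_mul, add_zero] at h0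
  obtain ⟨hP, hγ⟩ := h0
  cases B
  · obtain ⟨T, hT, hexit⟩ := exists_exit_down ha hb hab hP
    have e1 : ∀ x c : ℝ, x + orient false * T * c = x - T * c := by intros; simp [orient]; ring
    have hk : ∃ k, OnSide k (p - T * a) (q - T * b) := by
      rcases hexit with ⟨-, h⟩ | h | ⟨-, h⟩ <;> exact ⟨_, h⟩
    obtain ⟨k, hk⟩ := hk
    have hf := h.follow (T := T) hγ hP hT (by rw [e1, e1]; exact hk.1)
    rw [e1, e1, pt_glue hk] at hf
    exact up hk.reflect.1 hf
  · exact up hP hγ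

/-- The time `T` is the one that a run with word `l` from `s` to `s'` takes. -/
def IsDuration (a b : ℝ) (l : List Symbol) (s s' T : ℝ) : Prop :=
  T * a = (disp l).1 + (sec a b s').1 - (sec a b s).1 ∧
    T * b = (disp l).2 + (sec a b s').2 - (sec a b s).2

lemma IsDuration.cons {i : Symbol} {l : List Symbol} {s s' s'' τ T : ℝ}
    (h1 : τ * a = i.vec.1 + (sec a b s').1 - (sec a b s).1)
    (h2 : τ * b = i.vec.2 + (sec a b s').2 - (sec a b s).2) (h : IsDuration a b l s' s'' T) :
    IsDuration a b (i :: l) s s'' (τ + T) := by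
  obtain ⟨h3, h4⟩ := h
  simp only [IsDuration, disp_cons, Prod.fst_add, Prod.snd_add]
  constructor <;> linarith

lemma isDuration_self {l : List Symbol} {s T : ℝ} :
    IsDuration a b l s s T ↔ T * a = (disp l).1 ∧ T * b = (disp l).2 := by
  simp [IsDuration]

lemma IsTrajectory.eq_leg (h : IsTrajectory (vect a b) γ) {i : Symbol} {s s' t τ₁ τ : ℝ}
    {f : ℝ → Surface} (hf : IsLeg a b i s s' f τ₁ τ) (hγ : γ t = secPt a b s) :
    ∀ u ∈ Set.Icc 0 τ, γ (t + u) = f u :=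
  (h.isPath t τ).eq hf.isPath (by simpa [hf.start] using hγ) fun _ _ => h.nonsingular _

lemma IsTrajectory.exists_run (ha : 0 ≤ a) (hb : 0 ≤ b) (hab : 0 < a + b)
    (h : IsTrajectory (vect a b) γ) (n : ℕ) {t s : ℝ} (hs : s ∈ Set.Icc (-(a * φ)) (b * φ))
    (hγ : γ t = secPt a b s) : ∃ l s' T, l.length = n ∧ s' ∈ Set.Icc (-(a * φ)) (b * φ) ∧
      Run (Step a b) l s s' ∧ IsDuration a b l s s' T := by
  induction n generalizing t s with
  | zero => exact ⟨[], s, 0, rfl, hs, rfl, by simp [isDuration_self]⟩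
  | succ n ih =>
    obtain ⟨i, s', hi⟩ := h.exists_step ha hb hab hs hγ
    obtain ⟨f, τ₁, τ, hf⟩ := hi.exists_isLeg ha hb hab
    have hτ := h.eq_leg hf hγ τ ⟨(hf.pos.trans hf.lt).le, le_rfl⟩
    rw [hf.finish] at hτ
    have hs' := (hi.mem ha hb).2
    obtain ⟨l, s'', T, hl, hs'', hrun, hT⟩ := ih ⟨hs'.1.le, hs'.2.le⟩ hτ
    exact ⟨i :: l, s'', τ + T, by simp [hl], hs'', ⟨s', hi, hrun⟩, hT.cons hf.fst_eq hf.snd_eq⟩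

lemma sec_sum_mem (ha : 0 ≤ a) (hb : 0 ≤ b) (hab : 0 < a + b) {s : ℝ}
    (hs : s ∈ Set.Icc (-(a * φ)) (b * φ)) : (sec a b s).1 + (sec a b s).2 ∈ Set.Icc (-1) 0 := by
  obtain ⟨h1, h2, h3, h4, h5⟩ := pent_sec ha hb hab hs
  refine ⟨h2, ?_⟩
  have : (φ + 1) * ((sec a b s).1 + (sec a b s).2) ≤ 0 := by linarith
  have hφ := Real.goldenRatio_pos
  by_contra! hpos
  nlinarith

/-- Within a leg the sides 4 and 2 are met only at its start, so any visit to them happens between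
two legs of the run. -/
lemma IsTrajectory.exists_run_of_mem_sideOn (ha : 0 ≤ a) (hb : 0 ≤ b) (hab : 0 < a + b)
    (h : IsTrajectory (vect a b) γ) {l : List Symbol} {t s s' T u : ℝ}
    (hγ : γ t = secPt a b s) (hrun : Run (Step a b) l s s') (hT : IsDuration a b l s s' T)
    (hu : u ∈ Set.Ico 0 T) (hside : γ (t + u) ∈ sideOn .four ∨ γ (t + u) ∈ sideOn .two) :
    ∃ m r, Run (Step a b) m s r ∧ IsDuration a b m s r u ∧ γ (t + u) = secPt a b r ∧
      r ∈ Set.Icc (-(a * φ)) (b * φ) := by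
  induction l generalizing t s T u with
  | nil =>
    cases hrun
    rw [isDuration_self] at hT
    simp only [disp_nil, Prod.fst_zero, Prod.snd_zero] at hT
    have : T * (a + b) = 0 := by linarith [hT.1, hT.2]
    have hT0 := (mul_eq_zero.1 this).resolve_right hab.ne'
    linarith [hu.1, hu.2]
  | cons i l ih =>
    obtain ⟨z, hi, hrun⟩ := hrun
    obtain ⟨f, τ₁, τ, hf⟩ := hi.exists_isLeg ha hb hab
    have hleg := h.eq_leg hf hγ
    rcases lt_or_ge u τ with hlt | hle
    · rw [hleg u ⟨hu.1, hlt.le⟩, hf.mem_sideOn u ⟨hu.1, hlt⟩,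
        hf.mem_sideOn u ⟨hu.1, hlt⟩] at hside
      have hu0 : u = 0 := by
        obtain ⟨h4, h2⟩ := second_ne i
        rcases hside with (⟨h, -⟩ | ⟨-, h⟩) | ⟨h, -⟩ | ⟨-, h⟩
        exacts [h, absurd h.symm h4, h, absurd h.symm h2]
      subst hu0
      have hs := (hi.mem ha hb).1
      exact ⟨[], s, rfl, by simp [isDuration_self], by simpa using hγ, ⟨hs.1.le, hs.2.le⟩⟩
    · have hτ := hleg τ ⟨(hf.pos.trans hf.lt).le, le_rfl⟩
      rw [hf.finish] at hτ
      have e : t + τ + (u - τ) = t + u := by ring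
      have hT' : IsDuration a b l z s' (T - τ) := by
        obtain ⟨h1, h2⟩ := hT
        have h3 := hf.fst_eq
        have h4 := hf.snd_eq
        simp only [disp_cons, Prod.fst_add, Prod.snd_add] at h1 h2
        constructor <;> linarith
      obtain ⟨m, r, h1, h2, h3, h4⟩ := ih (u := u - τ) hτ hrun hT' ⟨by linarith, by linarith [hu.2]⟩
        (by rwa [e])
      refine ⟨i :: m, r, ⟨z, hi, h1⟩, ?_, by rwa [e] at h3, h4⟩
      have := h2.cons hf.fst_eq hf.snd_eq
      rwa [add_sub_cancel] at this

lemma secPt_mem_sideOn (ha : 0 ≤ a) (hb : 0 ≤ b) (hab : 0 < a + b) {s : ℝ}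
    (hs : s ∈ Set.Icc (-(a * φ)) (b * φ)) (hns : secPt a b s ∉ singular) :
    secPt a b s ∈ sideOn .four ∨ secPt a b s ∈ sideOn .two := by
  have hP := pent_sec ha hb hab hs
  have hc := fun hc => hns ((pt_mem_singular hP).2 hc)
  rw [secPt, pt_mem_sideOn hP hc, pt_mem_sideOn hP hc]
  rcases le_total s (b - a) with h | h
  · exact Or.inr (onSide_two_sec ha hb hab hs.1 h)
  · exact Or.inl (onSide_four_sec ha hb hab h hs.2)

lemma secPt_inj (ha : 0 ≤ a) (hb : 0 ≤ b) (hab : 0 < a + b) {s s' : ℝ}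
    (hs : s ∈ Set.Icc (-(a * φ)) (b * φ)) (hs' : s' ∈ Set.Icc (-(a * φ)) (b * φ))
    (hns : secPt a b s ∉ singular) (h : secPt a b s = secPt a b s') : s = s' := by
  have hP := pent_sec ha hb hab hs
  have h1 := sec_coord ha hb hab s
  have h2 := sec_coord ha hb hab s'
  rcases samePoint_of_pt_eq hP (pent_sec ha hb hab hs') h with h | ⟨-, e1, e2⟩ | ⟨h, -⟩
  · exact absurd ((pt_mem_singular hP).2 h.1) hns
  · rw [e1, e2] at h1; linarith
  · exact absurd rfl h

/-- The times after which a trajectory returns to its initial point come from loops. -/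
lemma IsTrajectory.exists_isLoop (ha : 0 ≤ a) (hb : 0 ≤ b) (hab : 0 < a + b)
    (h : IsTrajectory (vect a b) γ) {t s P : ℝ} (hs : s ∈ Set.Icc (-(a * φ)) (b * φ))
    (hγ : γ t = secPt a b s) (hP : 0 < P) (hper : γ (t + P) = γ t) :
    ∃ l, IsLoop (Step a b) l s ∧ IsDuration a b l s s P := by
  -- A run of `n` symbols outlasts `P`: its displacement has coordinate sum at least `n`, and the
  -- endpoints on the transversal change this by at most 1.
  obtain ⟨n, hn⟩ := exists_nat_gt (P * (a + b) + 1)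
  obtain ⟨l, s', T, hl, hs', hrun, hT⟩ := h.exists_run ha hb hab n hs hγ
  have hPT : P < T := by
    have h1 := length_le_disp l
    have h2 := sec_sum_mem ha hb hab hs
    have h3 := sec_sum_mem ha hb hab hs'
    rw [hl] at h1
    have : P * (a + b) < T * (a + b) := by linarith [hT.1, hT.2, h2.2, h3.1]
    exact lt_of_mul_lt_mul_right this hab.le
  have hns : secPt a b s ∉ singular := hγ ▸ h.nonsingular t
  obtain ⟨m, r, h1, h2, h3, h4⟩ := h.exists_run_of_mem_sideOn ha hb hab hγ hrun hT ⟨hP.le, hPT⟩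
    (by rw [hper, hγ]; exact secPt_mem_sideOn ha hb hab hs hns)
  obtain rfl : s = r := secPt_inj ha hb hab hs h4 hns (by rw [← hγ, ← hper, h3])
  refine ⟨m, ⟨?_, h1⟩, h2⟩
  rintro rfl
  rw [isDuration_self] at h2
  simp only [disp_nil, Prod.fst_zero, Prod.snd_zero] at h2
  nlinarith [h2.1, h2.2]

lemma exists_isPath_of_run (ha : 0 ≤ a) (hb : 0 ≤ b) (hab : 0 < a + b) {l : List Symbol}
    {s s' : ℝ} (hrun : Run (Step a b) l s s') : ∃ f T, IsPath a b f T ∧ 0 ≤ T ∧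
      f 0 = secPt a b s ∧ f T = secPt a b s' ∧ (∀ t ∈ Set.Ico 0 T, f t ∉ singular) ∧
      IsDuration a b l s s' T := by
  induction l generalizing s with
  | nil =>
    cases hrun
    refine ⟨fun _ => secPt a b s', 0, ⟨fun t ht => ?_, fun t ht => ?_⟩, le_rfl, rfl, rfl,
      fun t ht => ?_, by simp [isDuration_self]⟩
    · linarith [ht.1, ht.2]
    · linarith [ht.1, ht.2]
    · linarith [ht.1, ht.2]
  | cons i l ih =>
    obtain ⟨z, hi, hrun⟩ := hrun
    obtain ⟨f, τ₁, τ, hf⟩ := hi.exists_isLeg ha hb hab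
    obtain ⟨g, T, h1, h2, h3, h4, h5, h6⟩ := ih hrun
    have hτ := hf.pos.trans hf.lt
    refine ⟨concat f g τ, τ + T, hf.isPath.concat h1 (hf.finish.trans h3.symm), by linarith, ?_,
      ?_, fun t ht => ?_, h6.cons hf.fst_eq hf.snd_eq⟩
    · rw [concat_of_lt hτ, hf.start]
    · rw [concat_of_le (by linarith), add_sub_cancel_left, h4]
    · rcases lt_or_ge t τ with hlt | hle
      · rw [concat_of_lt hlt]; exact hf.nonsingular t ⟨ht.1, hlt⟩
      · rw [concat_of_le hle]; exact h5 _ ⟨by linarith, by linarith [ht.2]⟩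

lemma IsTrajectory.eq_of_run (ha : 0 ≤ a) (hb : 0 ≤ b) (hab : 0 < a + b)
    (h : IsTrajectory (vect a b) γ) {l : List Symbol} {t s s' T : ℝ} (hγ : γ t = secPt a b s)
    (hrun : Run (Step a b) l s s') (hT : IsDuration a b l s s' T) :
    γ (t + T) = secPt a b s' := by
  obtain ⟨f, T', h1, h2, h3, h4, h5, h6⟩ := exists_isPath_of_run ha hb hab hrun
  obtain rfl : T = T' := by
    have : T * (a + b) = T' * (a + b) := by linarith [hT.1, hT.2, h6.1, h6.2]
    exact mul_right_cancel₀ hab.ne' this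
  rw [← h4]
  exact (h.isPath t T).eq h1 (by simpa [h3] using hγ) (fun _ _ => h.nonsingular _) T ⟨h2, le_rfl⟩

/-- Trajectories that meet continue together. -/
lemma IsTrajectory.eq_add (h : IsTrajectory (vect a b) γ) {t t' : ℝ} (heq : γ t = γ t') {u : ℝ}
    (hu : 0 ≤ u) : γ (t + u) = γ (t' + u) :=
  (h.isPath t u).eq (h.isPath t' u) (by simpa using heq) (fun _ _ => h.nonsingular _) u
    ⟨hu, le_rfl⟩

lemma exists_duration {l : List Symbol} {s : ℝ} (ha : 0 ≤ a) (hb : 0 ≤ b) (hab : 0 < a + b)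
    (hl : IsLoop (Step a b) l s) : ∃ P, 0 < P ∧ IsDuration a b l s s P := by
  obtain ⟨f, T, h1, h2, h3, h4, h5, h6⟩ := exists_isPath_of_run ha hb hab hl.2
  refine ⟨T, h2.lt_of_ne ?_, h6⟩
  rintro rfl
  have := hl.disp_pos
  rw [isDuration_self] at h6
  linarith [h6.1, h6.2]

lemma disp_sum_le_of_append {l r : List Symbol} :
    (disp l).1 + (disp l).2 + r.length ≤ (disp (l ++ r)).1 + (disp (l ++ r)).2 := by
  have := length_le_disp r
  rw [disp_append, Prod.fst_add, Prod.snd_add]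
  linarith

/-- Every primitive loop is the one of a periodic orbit. -/
lemma exists_periodicOrbit (ha : 0 ≤ a) (hb : 0 ≤ b) (hab : 0 < a + b) {l : List Symbol} {s : ℝ}
    (hl : IsPrimitive (Step a b) l s) :
    ∃ O : PeriodicOrbit (vect a b), O.period * (a + b) = (disp l).1 + (disp l).2 := by
  obtain ⟨f, T, h1, h2, h3, h4, h5, h6⟩ := exists_isPath_of_run ha hb hab hl.1.2
  rw [isDuration_self] at h6
  have hsum : T * (a + b) = (disp l).1 + (disp l).2 := by linarith [h6.1, h6.2]
  have hT : 0 < T := h2.lt_of_ne <| by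
    rintro rfl
    linarith [hl.1.disp_pos]
  have htraj := h1.isTrajectory hT (h4.trans h3.symm) h5
  have hs : s ∈ Set.Icc (-(a * φ)) (b * φ) := by
    obtain ⟨i, z, -, hi, -⟩ := hl.1.exists_step
    exact Set.Ioo_subset_Icc_self (hi.mem ha hb).1
  refine ⟨⟨_, htraj, T, hT, fun t => by rw [toIcoMod_add_right], fun P hP hper => ?_⟩, hsum⟩
  -- Any period gives a loop at `s`, of which the primitive loop `l` is an initial part; so the
  -- period is at least `T`.
  obtain ⟨m, hm, hmP⟩ := htraj.exists_isLoop ha hb hab (t := 0) hs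
    (by simpa using h3) hP (hper 0)
  rw [isDuration_self] at hmP
  obtain ⟨r, rfl⟩ := hl.exists_append (step_deterministic ha hb) hm
  have := disp_sum_le_of_append (l := l) (r := r)
  have : T * (a + b) ≤ P * (a + b) := by linarith [hmP.1, hmP.2, Nat.cast_nonneg (α := ℝ) r.length]
  exact le_of_mul_le_mul_right this hab

/-- Every periodic orbit runs along a primitive loop. -/
lemma PeriodicOrbit.exists_isPrimitive (ha : 0 ≤ a) (hb : 0 ≤ b) (hab : 0 < a + b)
    (O : PeriodicOrbit (vect a b)) : ∃ t s l, O.γ t = secPt a b s ∧ IsPrimitive (Step a b) l s ∧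
      O.period * a = (disp l).1 ∧ O.period * b = (disp l).2 := by
  obtain ⟨t, s, hs, hγ⟩ := O.trajectory.exists_secPt ha hb hab
  obtain ⟨l, hl, hP⟩ := O.trajectory.exists_isLoop ha hb hab hs hγ O.period_pos (O.periodic t)
  rw [isDuration_self] at hP
  refine ⟨t, s, l, hγ, ⟨hl, fun m hm => ?_⟩, hP⟩
  by_contra! hlt
  obtain ⟨r, hr, -⟩ := (step_deterministic ha hb).exists_append hm.2 hl.2 hlt.le
  obtain ⟨T, hT, hdur⟩ := exists_duration ha hb hab hm
  have hret := O.trajectory.eq_of_run ha hb hab hγ hm.2 hdur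
  -- A return at the single time `t` propagates forwards by uniqueness; earlier times are first
  -- shifted beyond `t` by a multiple of `O.period`.
  have hper : Function.Periodic O.γ T := by
    intro x
    obtain ⟨n, hn⟩ := exists_nat_gt ((t - x) / O.period)
    rw [div_lt_iff₀ O.period_pos] at hn
    have hnper := O.periodic.nat_mul n
    have := O.trajectory.eq_add (hret.trans hγ.symm) (u := x + n * O.period - t) (by linarith)
    have e1 : t + T + (x + n * O.period - t) = x + T + n * O.period := by ring
    have e2 : t + (x + n * O.period - t) = x + n * O.period := by ring
    rw [e1, e2, hnper, hnper] at this
    exact this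
  have hle := O.period_le T hT hper
  rw [isDuration_self] at hdur
  have h1 := disp_sum_le_of_append (l := m) (r := r)
  rw [← hr] at h1
  have hrpos : (0 : ℝ) < r.length := by
    have := congrArg List.length hr
    rw [List.length_append] at this
    exact_mod_cast (by omega : 0 < r.length)
  have := mul_le_mul_of_nonneg_right hle hab.le
  linarith [hdur.1, hdur.2, hP.1, hP.2]

end Trajectories

/-! ### Counting pairs of consecutive labels -/

section Counting

variable {a b : ℝ} {γ : ℝ → Surface}

/-- The curve `γ` crosses side `i` at time `t`, and side `j` is the next side it crosses. -/
def CrossesAt (γ : ℝ → Surface) (i j : Label) (t : ℝ) : Prop :=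
  γ t ∈ sideOn i ∧ ∃ t' > t, γ t' ∈ sideOn j ∧ ∀ s ∈ Set.Ioo t t', ∀ k : Label, γ s ∉ sideOn k

lemma CrossesAt.add_period {c : ℝ} (hγ : Function.Periodic γ c) {i j : Label} {t : ℝ}
    (h : CrossesAt γ i j t) : CrossesAt γ i j (t + c) := by
  obtain ⟨h1, t', ht', h2, h3⟩ := h
  refine ⟨by rwa [hγ], t' + c, by linarith, by rwa [hγ], fun s hs k => ?_⟩
  have := h3 (s - c) ⟨by linarith [hs.1], by linarith [hs.2]⟩ k
  rwa [← hγ (s - c), sub_add_cancel] at this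

lemma ncard_crossesAt_shift {P : ℝ} (hP : 0 < P) (hγ : Function.Periodic γ P) (i j : Label)
    (t : ℝ) : {u | u ∈ Set.Ico 0 P ∧ CrossesAt γ i j u}.ncard =
      {u | u ∈ Set.Ico t (t + P) ∧ CrossesAt γ i j u}.ncard := by
  have hshift : ∀ (n : ℤ) u, CrossesAt γ i j u → CrossesAt γ i j (u - n • P) := fun n u hu => by
    have := hu.add_period (hγ.zsmul n).neg
    rwa [← sub_eq_add_neg] at this
  have hmod : ∀ c u, CrossesAt γ i j u → CrossesAt γ i j (toIcoMod hP c u) := fun c u hu =>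
    hshift _ _ hu
  have hself : ∀ c, ∀ u ∈ Set.Ico c (c + P), toIcoMod hP c u = u := fun c u hu =>
    (toIcoMod_eq_self hP).2 hu
  refine Set.ncard_congr (fun u _ => toIcoMod hP t u) ?_ ?_ ?_
  · rintro u ⟨hu, hc⟩
    exact ⟨toIcoMod_mem_Ico hP t u, hmod t u hc⟩
  · rintro u v ⟨hu, -⟩ ⟨hv, -⟩ huv
    have := congrArg (toIcoMod hP 0) huv
    simp only [toIcoMod_toIcoMod] at this
    rwa [hself 0 u (by simpa using hu), hself 0 v (by simpa using hv)] at this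
  · rintro v ⟨hv, hc⟩
    refine ⟨toIcoMod hP 0 v, ⟨by simpa using toIcoMod_mem_Ico hP 0 v, hmod 0 v hc⟩, ?_⟩
    rw [toIcoMod_toIcoMod, hself t v hv]

lemma symbol_ext {i j : Symbol} (h1 : i.first = j.first) (h2 : i.second = j.second) : i = j := by
  cases i <;> cases j <;> simp_all [first, second]

/-- A leg meets the sides only at its start and at `τ₁`, and the second side is never 4 or 2. So it
contributes one pair of the four kinds, its own, at its start. -/
lemma IsTrajectory.crossesAt_leg (h : IsTrajectory (vect a b) γ) {i : Symbol} {s s' t τ₁ τ : ℝ}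
    {f : ℝ → Surface} (hf : IsLeg a b i s s' f τ₁ τ) (hγ : γ t = secPt a b s) (j : Symbol) :
    {u | u ∈ Set.Ico t (t + τ) ∧ CrossesAt γ j.first j.second u} = if i = j then {t} else ∅ := by
  have hleg : ∀ u ∈ Set.Ico t (t + τ), ∀ m, γ u ∈ sideOn m ↔
      (u = t ∧ m = i.first) ∨ (u = t + τ₁ ∧ m = i.second) := by
    intro u hu m
    have hu' : u - t ∈ Set.Ico 0 τ := ⟨by linarith [hu.1], by linarith [hu.2]⟩
    have := h.eq_leg hf hγ (u - t) (Set.Ico_subset_Icc_self hu')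
    rw [add_sub_cancel] at this
    rw [this, hf.mem_sideOn _ hu', sub_eq_zero, sub_eq_iff_eq_add']
  have hpos := hf.pos
  have hlt := hf.lt
  have key : ∀ u, (u ∈ Set.Ico t (t + τ) ∧ CrossesAt γ j.first j.second u) ↔ u = t ∧ i = j := by
    intro u
    constructor
    · rintro ⟨hu, h1, t', ht', h2, h3⟩
      rw [hleg u hu] at h1
      rcases h1 with ⟨rfl, h1⟩ | ⟨-, h1⟩
      · refine ⟨rfl, symbol_ext h1.symm ?_⟩
        rcases lt_trichotomy t' (u + τ₁) with hlt' | rfl | hgt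
        · rcases (hleg t' ⟨by linarith, by linarith⟩ _).1 h2 with ⟨h4, -⟩ | ⟨h4, -⟩ <;> linarith
        · rcases (hleg _ ⟨by linarith, by linarith⟩ _).1 h2 with ⟨h4, -⟩ | ⟨-, h4⟩
          · linarith
          · exact h4.symm
        · exact absurd ((hleg (u + τ₁) ⟨by linarith, by linarith⟩ _).2 (Or.inr ⟨rfl, rfl⟩))
            (h3 _ ⟨by linarith, hgt⟩ i.second)
      · obtain ⟨h4, h5⟩ := second_ne i
        rcases first_eq j with h | h <;> rw [h] at h1
        · exact absurd h1.symm h4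
        · exact absurd h1.symm h5
    · rintro ⟨rfl, rfl⟩
      refine ⟨⟨le_rfl, by linarith⟩, (hleg u ⟨le_rfl, by linarith⟩ _).2 (Or.inl ⟨rfl, rfl⟩),
        u + τ₁, by linarith, (hleg _ ⟨by linarith, by linarith⟩ _).2 (Or.inr ⟨rfl, rfl⟩),
        fun r hr k hk => ?_⟩
      rcases (hleg r ⟨by linarith [hr.1], by linarith [hr.2]⟩ k).1 hk with ⟨h4, -⟩ | ⟨h4, -⟩ <;>
        linarith [hr.1, hr.2]
  ext u
  rw [Set.mem_ofPred_eq, key]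
  split_ifs with hij <;> simp [hij]

/-- Half-open time intervals make the counts of successive legs add; `encard` spares separate
finiteness proofs. -/
lemma IsTrajectory.encard_crossesAt (ha : 0 ≤ a) (hb : 0 ≤ b) (hab : 0 < a + b)
    (h : IsTrajectory (vect a b) γ) {l : List Symbol} {t s s' T : ℝ} (hγ : γ t = secPt a b s)
    (hrun : Run (Step a b) l s s') (hT : IsDuration a b l s s' T) (j : Symbol) :
    0 ≤ T ∧ {u | u ∈ Set.Ico t (t + T) ∧ CrossesAt γ j.first j.second u}.encard = l.count j := by
  induction l generalizing t s T with
  | nil =>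
    cases hrun
    rw [isDuration_self] at hT
    simp only [disp_nil, Prod.fst_zero, Prod.snd_zero] at hT
    have : T * (a + b) = 0 := by linarith [hT.1, hT.2]
    obtain rfl := (mul_eq_zero.1 this).resolve_right hab.ne'
    simp
  | cons i l ih =>
    obtain ⟨z, hi, hrun⟩ := hrun
    obtain ⟨f, τ₁, τ, hf⟩ := hi.exists_isLeg ha hb hab
    have hτpos := hf.pos.trans hf.lt
    have hτ := h.eq_leg hf hγ τ ⟨hτpos.le, le_rfl⟩
    rw [hf.finish] at hτ
    have hT' : IsDuration a b l z s' (T - τ) := by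
      obtain ⟨h1, h2⟩ := hT
      have h3 := hf.fst_eq
      have h4 := hf.snd_eq
      simp only [disp_cons, Prod.fst_add, Prod.snd_add] at h1 h2
      constructor <;> linarith
    obtain ⟨hnn, hcard⟩ := ih hτ hrun hT'
    refine ⟨by linarith, ?_⟩
    have hunion : {u | u ∈ Set.Ico t (t + T) ∧ CrossesAt γ j.first j.second u} =
        {u | u ∈ Set.Ico t (t + τ) ∧ CrossesAt γ j.first j.second u} ∪
        {u | u ∈ Set.Ico (t + τ) (t + τ + (T - τ)) ∧ CrossesAt γ j.first j.second u} := by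
      have e : t + τ + (T - τ) = t + T := by ring
      rw [e, ← Set.Ico_union_Ico_eq_Ico (b := t + τ) (by linarith : t ≤ t + τ) (by linarith)]
      ext u
      simp only [Set.mem_ofPred_eq, Set.mem_union, or_and_right]
    rw [hunion, Set.encard_union_eq, hcard, h.crossesAt_leg hf hγ]
    · rw [List.count_cons]
      by_cases hij : i = j
      · simp [hij, add_comm]
      · simp [hij]
    · rw [Set.disjoint_left]
      rintro u ⟨hu, -⟩ ⟨hu', -⟩
      linarith [hu.2, hu'.1]

lemma PeriodicOrbit.count_eq (ha : 0 ≤ a) (hb : 0 ≤ b) (hab : 0 < a + b)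
    (O : PeriodicOrbit (vect a b)) {t s : ℝ} {l : List Symbol} (hγ : O.γ t = secPt a b s)
    (hl : Run (Step a b) l s s) (h1 : O.period * a = (disp l).1) (h2 : O.period * b = (disp l).2)
    (j : Symbol) : O.count j.first j.second = l.count j := by
  have h := O.trajectory.encard_crossesAt ha hb hab hγ hl (isDuration_self.2 ⟨h1, h2⟩) j
  have h' := ncard_crossesAt_shift O.period_pos O.periodic j.first j.second t
  rw [Set.ncard_def {u | u ∈ Set.Ico t (t + O.period) ∧ _}, h.2] at h'
  exact h'

end Counting

/-! ### Lengths and the angle with the bisector -/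

section Metric

variable {a b : ℝ}

lemma vect_one_one : vect 1 1 = diagU + diagV := by simp [vect]

/-- The sum of the diagonals is vertical, so the cosine is the imaginary part of the unit vector. -/
lemma cos_angle_bisector (hw : ‖vect a b‖ = 1) :
    Real.cos (InnerProductGeometry.angle (vect a b) (diagU + diagV)) = height * (a + b) := by
  have hH := height_pos
  have hv : diagU + diagV = ((2 * height : ℝ) : ℂ) * Complex.I := by
    rw [← vect_one_one]
    apply Complex.ext
    · simp [vect_re]
    · simp [vect_im]; ring
  have hn : ‖diagU + diagV‖ = 2 * height := by
    rw [hv, norm_mul, Complex.norm_I, mul_one, Complex.norm_real, Real.norm_of_nonneg (by linarith)]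
  have hin : inner ℝ (vect a b) (diagU + diagV) = (2 * height) * (vect a b).im := by
    rw [hv, Complex.inner]
    simp
  rw [InnerProductGeometry.cos_angle, hw, hn, hin, vect_im]
  field_simp

end Metric

namespace PeriodicOrbit

variable {a b : ℝ}

lemma displacement_eq (O : PeriodicOrbit (vect a b)) :
    O.displacement = vect (O.period * a) (O.period * b) := by
  simp only [displacement, line, vect]
  push_cast
  ring

lemma exists_coordinates (ha : 0 ≤ a) (hb : 0 ≤ b) (hab : 0 < a + b)
    (O : PeriodicOrbit (vect a b)) : ∃ s l, IsPrimitive (Step a b) l s ∧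
      O.period * a = (disp l).1 ∧ O.period * b = (disp l).2 ∧
      disp l = (O.numI * φ + O.numIII, O.numIV * φ + O.numII) := by
  obtain ⟨t, s, l, hγ, hl, h1, h2⟩ := O.exists_isPrimitive ha hb hab
  have hcount := O.count_eq ha hb hab hγ hl.1.2 h1 h2
  refine ⟨s, l, hl, h1, h2, ?_⟩
  rw [disp_eq, ← hcount I, ← hcount II, ← hcount III, ← hcount IV]
  rfl

end PeriodicOrbit

end DoublePentagon

open DoublePentagon in
theorem theorem8 (w : ℂ) (hw : ‖w‖ = 1) (hsector : w ∈ sector)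
    (hperiodic : Nonempty (PeriodicOrbit w)) :
    (∃ S : PeriodicOrbit w, S.IsShort) ∧ (∃ L : PeriodicOrbit w, L.IsLong) ∧
    (∀ O : PeriodicOrbit w, O.IsShort ∨ O.IsLong) ∧
    ∀ S L : PeriodicOrbit w, S.IsShort → L.IsLong →
      S.displacement =
          (S.numI * Real.goldenRatio + S.numIII : ℝ) * diagU
            + (S.numIV * Real.goldenRatio + S.numII : ℝ) * diagV ∧
      L.displacement =
          (L.numI * Real.goldenRatio + L.numIII : ℝ) * diagU
            + (L.numIV * Real.goldenRatio + L.numII : ℝ) * diagV ∧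
      S.length =
          Real.goldenRatio ^ 2 * Real.sin (Real.pi / 5)
              / Real.cos (InnerProductGeometry.angle w (diagU + diagV))
            * ((S.numI + S.numIV) * Real.goldenRatio + (S.numII + S.numIII)) ∧
      L.length = Real.goldenRatio * S.length := by
  obtain ⟨a, b, ha, hb, hab⟩ := hsector
  obtain rfl : w = vect a b := hab
  have hpos : 0 < a + b := by
    refine (add_nonneg ha hb).lt_of_ne fun h => ?_
    have ha0 : a = 0 := by linarith
    have hb0 : b = 0 := by linarith
    rw [ha0, hb0] at hw
    simp [vect] at hw
  have hlen : ∀ O : PeriodicOrbit (vect a b), O.length = O.period := fun O => by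
    rw [PeriodicOrbit.length, hw, one_mul]
  have hφ := Real.one_lt_goldenRatio
  obtain ⟨O₀⟩ := hperiodic
  obtain ⟨s₀, l₀, hl₀, -⟩ := O₀.exists_coordinates ha hb hpos
  obtain ⟨D, ⟨l₁, s₁, hl₁, hD₁⟩, ⟨l₂, s₂, hl₂, hD₂⟩, hall⟩ :=
    twoLoops_of_isLoop ha hb hpos hl₀.1
  obtain ⟨O₁, hO₁⟩ := exists_periodicOrbit ha hb hpos hl₁
  obtain ⟨O₂, hO₂⟩ := exists_periodicOrbit ha hb hpos hl₂
  have hDpos : 0 < D.1 + D.2 := hD₁ ▸ hl₁.1.disp_pos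
  -- At unit speed length equals period, and a period is the coordinate sum of the displacement
  -- divided by `a + b`. Hence the only lengths are `p` and `φ * p`, and both occur.
  set p := (D.1 + D.2) / (a + b) with hp
  have hp0 : 0 < p := div_pos hDpos hpos
  have hp1 : O₁.length = p := by
    rw [hlen, hp, eq_div_iff hpos.ne', hO₁, hD₁]
  have hp2 : O₂.length = Real.goldenRatio * p := by
    rw [hlen, hp, ← mul_div_assoc, eq_div_iff hpos.ne', hO₂, hD₂, Prod.smul_fst, Prod.smul_snd,
      smul_eq_mul, smul_eq_mul, mul_add]
  have hlt : p < Real.goldenRatio * p := lt_mul_of_one_lt_left hp0 hφ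
  have hcases : ∀ O : PeriodicOrbit (vect a b),
      O.length = p ∨ O.length = Real.goldenRatio * p := by
    intro O
    obtain ⟨s, l, hl, h1, h2, -⟩ := O.exists_coordinates ha hb hpos
    rw [hlen, hp, ← mul_div_assoc, eq_div_iff hpos.ne', eq_div_iff hpos.ne', mul_add, h1, h2]
    refine (hall l s hl).imp (fun h => by rw [h]) fun h => ?_
    rw [h, Prod.smul_fst, Prod.smul_snd, smul_eq_mul, smul_eq_mul, mul_add]
  have hshort : ∀ O : PeriodicOrbit (vect a b), O.IsShort ↔ O.length = p := by
    refine fun O => ⟨fun h => ?_, fun h O' => ?_⟩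
    · have := h O₁
      rcases hcases O with h' | h' <;> linarith
    · rcases hcases O' with h' | h' <;> linarith
  have hlong : ∀ O : PeriodicOrbit (vect a b), O.IsLong ↔ O.length = Real.goldenRatio * p := by
    refine fun O => ⟨fun h => ?_, fun h O' => ?_⟩
    · have := h O₂
      rcases hcases O with h' | h' <;> linarith
    · rcases hcases O' with h' | h' <;> linarith
  have hdisp : ∀ O : PeriodicOrbit (vect a b), O.displacement =
      (O.numI * Real.goldenRatio + O.numIII : ℝ) * diagU
        + (O.numIV * Real.goldenRatio + O.numII : ℝ) * diagV := by
    intro O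
    obtain ⟨s, l, -, h1, h2, h3⟩ := O.exists_coordinates ha hb hpos
    rw [O.displacement_eq, h1, h2, h3]
    rfl
  refine ⟨⟨O₁, (hshort O₁).2 hp1⟩, ⟨O₂, (hlong O₂).2 hp2⟩,
    fun O => (hcases O).imp (hshort O).2 (hlong O).2, fun S L hS hL => ⟨hdisp S, hdisp L, ?_, ?_⟩⟩
  · obtain ⟨s, l, -, h1, h2, h3⟩ := S.exists_coordinates ha hb hpos
    rw [h3] at h1 h2
    simp only at h1 h2
    have hH := height_pos
    -- The constant `m` becomes `height / (height * (a + b))`, so the claim reduces to the sum of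
    -- the two coordinate equations.
    rw [cos_angle_bisector hw, ← height_eq, hlen, div_mul_eq_mul_div, eq_div_iff (by positivity)]
    linear_combination height * (h1 + h2)
  · rw [(hlong L).1 hL, (hshort S).1 hS]
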